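/- **Conventions.** For $\mathcal F\subseteq[\mathbb N]^{<\infty}$ and infinite $M=\{M(1)<M(2)<\dots\}\subseteq\mathbb N$ put $\mathcal F\upharpoonright M=\{s\in\mathcal F: s\subseteq M\}$ and let $\widehat{\mathcal F}$ be the set of all initial segments of members of $\mathcal F$. The family $\mathcal F$ is *regular thin* if no member is a proper initial segment of another and $\widehat{\mathcal F}$ is closed under subsets, spreading (if $\{n_1<\dots<n_k\}\in\widehat{\mathcal F}$ and $m_1<\dots<m_k$ with $n_i\le m_i$, then $\{m_1,\dots,m_k\}\in\widehat{\mathcal F}$) and closed in $\{0,1\}^{\mathbb N}$. Write $s(k)$ for the $k$-th element of $s$. A tuple $(s_j)_{j=1}^l$ of nonempty finite sets is *plegma* if $s_i(k)<s_j(k)$ for $i<j$, $k\le\min(|s_i|,|s_j|)$, and $s_i(k)<s_j(k+1)$ for all $i,j$ and $k\le\min(|s_i|,|s_j|-1)$. The subsequence $(x_s)_{s\in\mathcal F\upharpoonright M}$ in a Banach space *generates* $(e_n)_n$ (a Hamel basis of a seminormed space $(E,\|\cdot\|_*)$) as an $\mathcal F$-spreading model if for some null sequence $(\delta_l)_l$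 of positive reals $$\Big|\big\|\textstyle\sum_{j=1}^k a_jx_{s_j}\big\|-\big\|\sum_{j=1}^k a_je_j\big\|_*\Big|\le\delta_l$$ for all $1\le k\le l$, $a_j\in[-1,1]$ and plegma $(s_j)_{j=1}^k$ in $\mathcal F\upharpoonright M$ with $s_1(1)\ge M(l)$. An $\mathcal F$-spreading model of $(x_s)_{s\in\mathcal F\upharpoonright L}$ is a sequence generated by $(x_s)_{s\in\mathcal F\upharpoonright M}$ for some infinite $M\subseteq L$. The subsequence $(x_s)_{s\in\mathcal F\upharpoonright L}$ is *subordinated* if $s\mapsto x_s$ extends to a continuous map from $\widehat{\mathcal F}\upharpoonright L\subseteq\{0,1\}^{\mathbb N}$ to $X$ with the weak topology; $x_0$ is its weak limit if for every weakly open $U\ni x_0$ there is $m$ with $x_s\in U$ for all $s\in\mathcal F\upharpoonright L$ with $\min s\ge L(m)$. A spreading sequence $(e_n)_n$ (that is, $\|\sum_{j=1}^n a_je_j\|_*=\|\sum_{j=1}^n a_je_{k_j}\|_*$ for all $n$, real $a_1,\dots,a_n$ and $k_1<\dots<k_n$) is *trivial* if $\|e_n-e_m\|_*=0$ for all $n,m$,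 and *singular* if it is nontrivial and not Schauder basic. The *natural decomposition* of a singular $(e_n)_n$ is $e_n=e'_n+e$, where $e\neq0$ is the weak limit of $(e_n)_n$ in the completion of $E$. **Theorem.** Let $X$ be a real Banach space, $\mathcal F$ a regular thin family containing a nonempty set, $L\subseteq\mathbb N$ infinite, and $(x_s)_{s\in\mathcal F\upharpoonright L}$ an $\mathcal F$-subsequence in $X$ generating a nontrivial $\mathcal F$-spreading model $(e_n)_n$. Assume that $(x_s)_{s\in\mathcal F\upharpoonright L}$ is subordinated with respect to the weak topology, let $x_0$ be its weak limit, and let $x'_s=x_s-x_0$. If $x_0\neq0$, then exactly one of the following holds. (i) The sequence $(e_n)_n$, as well as every $\mathcal F$-spreading model of $(x'_s)_{s\in\mathcal F\upharpoonright L}$, is equivalent to the usual basis of $\ell^1$. (ii) The sequence $(e_n)_n$ is singular and, if $e_n=e'_n+e$ is its natural decomposition, then $\|e\|=\|x_0\|$ and $(e'_n)_n$ is an $\mathcal F$-spreading model of $(x'_s)_{s\in\mathcal F\upharpoonright L}$, unique up to isometry: for every $\mathcal F$-spreading model $(\widetilde e_n)_n$ of $(x'_s)_{s\in\mathcal F\upharpoonright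 L}$, $e'_n\mapsto\widetilde e_n$ extends to a linear isometry of the linear spans. -/

import Mathlib

open Filter Topology

universe u v w

namespace FSpreading

/-! ### Families of finite subsets of `ℕ`

Everything below depends only on the order type of `ℕ`, so Lean's `ℕ` (starting at `0`) is used for
the positive integers, and all enumerations are indexed from `0`. -/

/-- `t` is an initial segment of `s`. -/
def IsInitSeg (t s : Finset ℕ) : Prop :=
  t ⊆ s ∧ ∀ m ∈ s, m ∉ t → ∀ n ∈ t, n < m

/-- The closure of a family under initial segments. -/
def hat (F : Set (Finset ℕ)) : Set (Finset ℕ) :=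
  {t | ∃ s ∈ F, IsInitSeg t s}

/-- The restriction of the family `F` to the set `M`: the members of `F` contained in `M`. -/
def restrict (F : Set (Finset ℕ)) (M : Set ℕ) : Set (Finset ℕ) :=
  {s | s ∈ F ∧ (s : Set ℕ) ⊆ M}

/-- The characteristic function of `s` as a point of the Cantor space. -/
def charFn (s : Finset ℕ) : ℕ → Bool := fun n => decide (n ∈ s)

/-- No member of `F` is a proper initial segment of another member. -/
def IsThin (F : Set (Finset ℕ)) : Prop :=
  ∀ s ∈ F, ∀ t ∈ F, IsInitSeg s t → s = t

/-- Compact, hereditary and spreading families. -/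
structure IsRegular (R : Set (Finset ℕ)) : Prop where
  compact : IsClosed (charFn '' R)
  hereditary : ∀ s ∈ R, ∀ t : Finset ℕ, t ⊆ s → t ∈ R
  spreading : ∀ (k : ℕ) (n m : Fin k → ℕ), StrictMono n → StrictMono m → (∀ i, n i ≤ m i) →
    Finset.univ.image n ∈ R → Finset.univ.image m ∈ R

/-- Thin families whose closure under initial segments is regular. -/
structure IsRegularThin (F : Set (Finset ℕ)) : Prop where
  thin : IsThin F
  regular : IsRegular (hat F)

/-- The `k`-th element (counted from `0`) of a set of natural numbers in its increasing
enumeration; for finite sets it is only used when `k` is smaller than the cardinality. -/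
noncomputable def elt (M : Set ℕ) (k : ℕ) : ℕ := Nat.nth (fun n => n ∈ M) k

/-- Plegma families `(s_1, …, s_l)` of nonempty finite sets. -/
structure IsPlegma {l : ℕ} (s : Fin l → Finset ℕ) : Prop where
  nonempty : ∀ i, (s i).Nonempty
  lt_same : ∀ i j : Fin l, i < j → ∀ k, k < (s i).card → k < (s j).card →
    elt (s i) k < elt (s j) k
  lt_succ : ∀ i j : Fin l, ∀ k, k < (s i).card → k + 1 < (s j).card →
    elt (s i) k < elt (s j) (k + 1)

/-! ### `F`-sequences

An `F`-sequence is represented by a function on all finite sets, of which only the values on `F`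
(for a subsequence: on `restrict F M`) are ever used. -/

/-- The `F`-subsequence `(y_s)`, `s ∈ restrict F M`, converges to `y₀`: every neighbourhood of `y₀`
contains all `y_s` with `min s ≥ M(m)`, for some `m`. -/
def FConverges {Y : Type*} [TopologicalSpace Y] (F : Set (Finset ℕ)) (M : Set ℕ)
    (y : Finset ℕ → Y) (y₀ : Y) : Prop :=
  ∀ U : Set Y, IsOpen U → y₀ ∈ U →
    ∃ m : ℕ, ∀ s ∈ restrict F M, (∀ n ∈ s, elt M m ≤ n) → y s ∈ U

/-- The `F`-subsequence `(y_s)`, `s ∈ restrict F M`, is subordinated: it extends to a continuous map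
on the restriction of `hat F` to `M`, seen as a subspace of the Cantor space. -/
def IsSubordinated {Y : Type*} [TopologicalSpace Y] (F : Set (Finset ℕ)) (M : Set ℕ)
    (y : Finset ℕ → Y) : Prop :=
  ∃ φ : (ℕ → Bool) → Y, ContinuousOn φ (charFn '' restrict (hat F) M) ∧
    ∀ s ∈ restrict F M, φ (charFn s) = y s

section Sequences

variable {E : Type*} [SeminormedAddCommGroup E] [NormedSpace ℝ E]

/-- The `F`-subsequence `(x_s)`, `s ∈ restrict F M`, generates `(e_n)` as an `F`-spreading model.
The seminormed space of the model is the linear span of `(e_n)` with the seminorm inherited from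
`E`; linear independence says that `(e_n)` is a Hamel basis of it. The tuple `s` has `k + 1`
members, `elt M l` is the `(l + 1)`-st element of `M`, and `∀ n ∈ s 0, elt M l ≤ n` says that the
least element of the first member is at least that. -/
def Generates {X : Type*} [NormedAddCommGroup X] [NormedSpace ℝ X] (F : Set (Finset ℕ))
    (M : Set ℕ) (x : Finset ℕ → X) (e : ℕ → E) : Prop :=
  LinearIndependent ℝ e ∧
  ∃ δ : ℕ → ℝ, (∀ l, 0 < δ l) ∧ Tendsto δ atTop (𝓝 0) ∧
    ∀ l k : ℕ, k ≤ l → ∀ a : Fin (k + 1) → ℝ, (∀ i, a i ∈ Set.Icc (-1 : ℝ) 1) →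
      ∀ s : Fin (k + 1) → Finset ℕ, (∀ i, s i ∈ restrict F M) → IsPlegma s →
        (∀ n ∈ s 0, elt M l ≤ n) →
          |‖∑ i, a i • x (s i)‖ - ‖∑ i, a i • e (i : ℕ)‖| ≤ δ l

/-- `(e_n)` is an `F`-spreading model of the `F`-subsequence `(x_s)`, `s ∈ restrict F L`: some
further subsequence generates it. -/
def IsSpreadingModelOf {X : Type*} [NormedAddCommGroup X] [NormedSpace ℝ X] (F : Set (Finset ℕ))
    (L : Set ℕ) (x : Finset ℕ → X) (e : ℕ → E) : Prop :=
  ∃ M : Set ℕ, M ⊆ L ∧ M.Infinite ∧ Generates F M x e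

/-- Spreading sequences. -/
def IsSpreading (e : ℕ → E) : Prop :=
  ∀ (n : ℕ) (a : Fin n → ℝ) (k : Fin n → ℕ), StrictMono k →
    ‖∑ j, a j • e (j : ℕ)‖ = ‖∑ j, a j • e (k j)‖

/-- Triviality of a spreading sequence. -/
def IsTrivial (e : ℕ → E) : Prop := ∀ n m, ‖e n - e m‖ = 0

/-- Schauder basic sequences. -/
def IsSchauderBasic (e : ℕ → E) : Prop :=
  ∃ C : ℝ, 1 ≤ C ∧ ∀ (a : ℕ → ℝ) (k m : ℕ), k ≤ m →
    ‖∑ n ∈ Finset.range k, a n • e n‖ ≤ C * ‖∑ n ∈ Finset.range m, a n • e n‖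

/-- Singular sequences: nontrivial spreading sequences which are not Schauder basic. -/
structure IsSingular (e : ℕ → E) : Prop where
  spreading : IsSpreading e
  nontrivial : ¬ IsTrivial e
  not_basic : ¬ IsSchauderBasic e

/-- `e n = (e n - e₀) + e₀` is the natural decomposition of `(e_n)`: the nonzero vector `e₀` is the
weak limit of `(e_n)`. The limit is taken in the completion, where the closed linear span
of `(e_n)` lives (the linear span need not contain it). -/
structure IsNaturalDecomposition (e : ℕ → E) (e₀ : UniformSpace.Completion E) : Prop where
  ne_zero : e₀ ≠ 0
  weak_limit : Tendsto
    (fun n => toWeakSpace ℝ (UniformSpace.Completion E) (e n : UniformSpace.Completion E))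
    atTop (𝓝 (toWeakSpace ℝ (UniformSpace.Completion E) e₀))

variable {E' : Type*} [SeminormedAddCommGroup E'] [NormedSpace ℝ E']

/-- `e_n ↦ e'_n` extends to a linear isometry of the linear spans. -/
def IsometricSeq (e : ℕ → E) (e' : ℕ → E') : Prop :=
  ∀ (n : ℕ) (a : ℕ → ℝ),
    ‖∑ i ∈ Finset.range n, a i • e i‖ = ‖∑ i ∈ Finset.range n, a i • e' i‖

/-- Equivalence of sequences. -/
def EquivSeq (e : ℕ → E) (e' : ℕ → E') : Prop :=
  ∃ c C : ℝ, 0 < c ∧ 0 < C ∧ ∀ (n : ℕ) (a : ℕ → ℝ),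
    c * ‖∑ i ∈ Finset.range n, a i • e' i‖ ≤ ‖∑ i ∈ Finset.range n, a i • e i‖ ∧
    ‖∑ i ∈ Finset.range n, a i • e i‖ ≤ C * ‖∑ i ∈ Finset.range n, a i • e' i‖

end Sequences

/-- The usual basis of `ℓ¹`. -/
noncomputable def l1Basis (n : ℕ) : lp (fun _ : ℕ => ℝ) 1 := lp.single 1 n (1 : ℝ)

end FSpreading

open FSpreading

namespace FSpreading

variable {F : Set (Finset ℕ)}

/-! ### Regular thin families -/

/-! Fix an ultrafilter `U` on `ℕ` that contains `L` and is finer than `atTop`. Choosing elements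
`U`-generically, one at a time and in round robin order, gives random tuples of members of `F`
(`generic`) and, in the limit, random sequences (`genericSeq`). Compactness of `hat F` makes the
recursion terminate (`IsRegularThin.wellFounded_tupleStep`). Generic tuples are plegma; conversely,
every plegma tuple in `F` can be replayed as such a construction (`PlegmaOn.isNext_below`), so
generic properties hold for all plegma tuples far out in some infinite set
(`exists_subset_forall_plegma`).

Put `y s = x s - x₀`. Norms of combinations of `y` along `genericSeq` converge to a seminorm `q` on
coefficient vectors (`exists_limit_seminorm`). On vectors of coefficient sum zero `x₀` cancels, so
there `q` is the norm given by `e`, and by every spreading model of `y`. Subordination makes each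
coordinate of `y` weakly null; norm conditions are convex, so by Mazur's theorem deleting a
coordinate does not increase `q` (`IsWeakExtension.erase_le`).

The dichotomy is whether `q` is bounded below on convex combinations. If it is, suppressing
coordinates isolates positive and negative parts, and an `ℓ¹` lower bound follows for `e` and for
all models of `y` (`norm_lower_bound`). If not, there are convex combinations `b m` with `q (b m) →
0`. The corresponding combinations of `e` are Cauchy; their limit `e₀` has norm `‖x₀‖`, because the
norm given by `e` differs from that of `σ a • x₀` by at most `q a`. A seminorm which agrees with `q`
on sum zero and vanishes along `b` equals `q` (`norm_eq_of_tendsto_zero`). This applies to `e n -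
e₀` and to every model of `y`, whence uniqueness; existence is a diagonalization
(`exists_approximates`). Were `e` basic, the norms of its combinations `b m` would tend to `0`,
contradicting `x₀ ≠ 0`. Hence also the two cases exclude each other. -/

lemma IsInitSeg.refl (s : Finset ℕ) : IsInitSeg s s := ⟨subset_rfl, fun _ h h' => absurd h h'⟩

lemma subset_hat : F ⊆ hat F := fun s hs => ⟨s, hs, .refl s⟩

lemma IsThin.empty_notMem (h : IsThin F) (h₁ : ∃ s ∈ F, s.Nonempty) : ∅ ∉ F := by
  rintro h0
  obtain ⟨s, hs, hne⟩ := h₁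
  have := h ∅ h0 s hs ⟨by simp, by simp⟩
  simp [← this] at hne

lemma IsThin.nonempty_of_mem (h : IsThin F) (h₁ : ∃ s ∈ F, s.Nonempty) {s : Finset ℕ}
    (hs : s ∈ F) : s.Nonempty := by
  rw [Finset.nonempty_iff_ne_empty]
  rintro rfl
  exact h.empty_notMem h₁ hs

lemma empty_mem_hat (h : F.Nonempty) : ∅ ∈ hat F := by
  obtain ⟨s, hs⟩ := h
  exact ⟨s, hs, by simp, by simp⟩

lemma strictMono_snoc {k : ℕ} {f : Fin k → ℕ} (hf : StrictMono f) {a : ℕ} (ha : ∀ i, f i < a) :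
    StrictMono (Fin.snoc f a : Fin (k + 1) → ℕ) := by
  intro i j hij
  induction j using Fin.lastCases with
  | last =>
    induction i using Fin.lastCases with
    | last => exact absurd hij (lt_irrefl _)
    | cast i => simpa using ha i
  | cast j =>
    induction i using Fin.lastCases with
    | last => exact absurd hij (not_lt.2 (Fin.le_last _))
    | cast i => simpa using hf (by simpa using hij)

lemma image_snoc_orderEmbOfFin (t : Finset ℕ) (a : ℕ) :
    Finset.univ.image (Fin.snoc (t.orderEmbOfFin rfl) a : Fin (t.card + 1) → ℕ) = insert a t := by
  ext n
  simp only [Finset.mem_image, Finset.mem_univ, true_and, Finset.mem_insert]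
  constructor
  · rintro ⟨i, rfl⟩
    induction i using Fin.lastCases with
    | last => simp
    | cast i => right; simp
  · rintro (rfl | h)
    · exact ⟨Fin.last _, by simp⟩
    · have : n ∈ Set.range (t.orderEmbOfFin rfl) := by simpa using h
      obtain ⟨i, rfl⟩ := this
      exact ⟨i.castSucc, by simp⟩

/-- A member of `hat F` outside `F` can be prolonged by all sufficiently large integers. -/
lemma IsRegularThin.eventually_insert_mem_hat (hF : IsRegularThin F) {t : Finset ℕ}
    (ht : t ∈ hat F) (htF : t ∉ F) : ∀ᶠ m in atTop, insert m t ∈ hat F := by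
  obtain ⟨s, hs, hts, hlt⟩ := ht
  have hne : ∃ m ∈ s, m ∉ t := by
    by_contra! h
    exact htF (by rwa [Finset.Subset.antisymm hts h])
  obtain ⟨p, hps, hpt⟩ := hne
  have hp : insert p t ∈ hat F :=
    hF.regular.hereditary s (subset_hat hs) _ (Finset.insert_subset hps hts)
  filter_upwards [eventually_ge_atTop p] with m hm
  have hlt' : ∀ i, t.orderEmbOfFin rfl i < p := fun i => hlt p hps hpt _ (by simp)
  -- Spreading moves the last element from `p` up to `m` and fixes the others.
  rw [← image_snoc_orderEmbOfFin] at hp ⊢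
  refine hF.regular.spreading _ _ _ (strictMono_snoc (t.orderEmbOfFin rfl).strictMono hlt')
    (strictMono_snoc (t.orderEmbOfFin rfl).strictMono fun i => (hlt' i).trans_le hm) ?_ hp
  intro i
  induction i using Fin.lastCases with
  | last => simpa using hm
  | cast i => simp

/-- One-point end extensions of members of `R`. -/
def EndExt (R : Set (Finset ℕ)) (t' t : Finset ℕ) : Prop :=
  t ∈ R ∧ ∃ m, (∀ n ∈ t, n < m) ∧ t' = insert m t

/-- Compactness of a hereditary family of finite sets excludes infinite end extension chains. -/
lemma wellFounded_endExt {R : Set (Finset ℕ)} (hR : IsClosed (charFn '' R)) :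
    WellFounded (EndExt R) := by
  rw [wellFounded_iff_isEmpty_descending_chain]
  refine ⟨fun ⟨f, hf⟩ => ?_⟩
  have hmono : Monotone f := monotone_nat_of_le_succ fun n => by
    obtain ⟨-, m, -, h⟩ := hf n
    rw [h]
    exact Finset.subset_insert _ _
  have hcard : ∀ n, n ≤ (f n).card := fun n => by
    induction n with
    | zero => simp
    | succ n ih =>
      obtain ⟨-, m, hm, h⟩ := hf n
      rw [h, Finset.card_insert_of_notMem fun h => lt_irrefl _ (hm m h)]
      omega
  classical
  -- The chain converges to its union, which by compactness is a finite member `s`; but `f (s.card +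
  -- 1)` is too large to be contained in it.
  have hlim : Tendsto (fun n => charFn (f n)) atTop (𝓝 fun j => decide (∃ n, j ∈ f n)) := by
    rw [tendsto_pi_nhds]
    intro j
    refine tendsto_const_nhds.congr' ?_
    by_cases h : ∃ n, j ∈ f n
    · obtain ⟨n, hn⟩ := h
      filter_upwards [eventually_ge_atTop n] with k hk
      have h1 : j ∈ f k := hmono hk hn
      have h2 : ∃ n, j ∈ f n := ⟨n, hn⟩
      simp [charFn, h1, h2]
    · refine Eventually.of_forall fun k => ?_
      have h1 : j ∉ f k := fun h' => h ⟨k, h'⟩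
      simp only [charFn, h, h1]
  have hmem := hR.mem_of_tendsto hlim
    (Eventually.of_forall fun n => ⟨f n, (hf n).1, rfl⟩)
  obtain ⟨s, -, hs⟩ := hmem
  have hsub : f (s.card + 1) ⊆ s := fun j hj => by
    have := congrFun hs j
    have h2 : ∃ n, j ∈ f n := ⟨_, hj⟩
    simpa [charFn, h2] using this
  have := Finset.card_le_card hsub
  have := hcard (s.card + 1)
  omega

/-! ### Round robin construction of tuples -/

/-- The coordinates in `I` at which the tuple `t` is still unfinished. -/
def IsActive (F : Set (Finset ℕ)) (I : Finset ℕ) (t : ℕ → Finset ℕ) (j : ℕ) : Prop :=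
  j ∈ I ∧ t j ∈ hat F ∧ t j ∉ F

/-- The unfinished coordinate which comes next in a round robin enumeration. -/
def IsNext (F : Set (Finset ℕ)) (I : Finset ℕ) (t : ℕ → Finset ℕ) (j : ℕ) : Prop :=
  IsActive F I t j ∧ ∀ i, IsActive F I t i →
    (t j).card < (t i).card ∨ (t j).card = (t i).card ∧ j ≤ i

/-- Add the element `m` to the `j`-th member of `t`. -/
def addElt (t : ℕ → Finset ℕ) (j m : ℕ) : ℕ → Finset ℕ :=
  Function.update t j (insert m (t j))

variable {I J : Finset ℕ} {t t' : ℕ → Finset ℕ} {i j m : ℕ}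

@[simp] lemma addElt_self : addElt t j m j = insert m (t j) := by simp [addElt]

lemma addElt_of_ne (h : i ≠ j) : addElt t j m i = t i := by simp [addElt, h]

lemma IsNext.unique (hi : IsNext F I t i) (hj : IsNext F I t j) : i = j := by
  rcases hi.2 j hj.1 with h | ⟨h, h'⟩ <;> rcases hj.2 i hi.1 with h2 | ⟨h2, h3⟩ <;> omega

lemma exists_isNext (h : ∃ j, IsActive F I t j) : ∃ j, IsNext F I t j := by
  classical
  obtain ⟨j₀, h0⟩ := h
  obtain ⟨j, hj, hmin⟩ := (I.filter (IsActive F I t)).exists_min_image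
    (fun j => toLex ((t j).card, j)) ⟨j₀, by simpa using ⟨h0.1, h0⟩⟩
  refine ⟨j, by simpa using (Finset.mem_filter.1 hj).2, fun i hi => ?_⟩
  have := hmin i (Finset.mem_filter.2 ⟨hi.1, hi⟩)
  simpa [Prod.Lex.toLex_le_toLex] using this

/-- One step of the construction. -/
def TupleStep (F : Set (Finset ℕ)) (I : Finset ℕ) (t' t : ℕ → Finset ℕ) : Prop :=
  ∃ j ∈ I, ∃ m, t j ∈ hat F ∧ (∀ n ∈ t j, n < m) ∧ t' = addElt t j m

/-- A step end-extends a single coordinate, so it decreases in the lexicographic product of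
well-founded relations over the finite set `I`. -/
lemma IsRegularThin.wellFounded_tupleStep (hF : IsRegularThin F) (I : Finset ℕ) :
    WellFounded (TupleStep F I) := by
  have h : WellFounded (Pi.Lex (· < ·) fun {_ : I} => EndExt (hat F)) :=
    Pi.Lex.wellFounded _ fun _ => wellFounded_endExt hF.regular.compact
  refine Subrelation.wf (r := InvImage (Pi.Lex (· < ·) fun {_ : I} => EndExt (hat F))
    fun (t : ℕ → Finset ℕ) (i : I) => t i) ?_ (InvImage.wf _ h)
  rintro t' t ⟨j, hj, m, ht, hm, rfl⟩
  refine ⟨⟨j, hj⟩, fun i hi => ?_, ?_⟩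
  · exact addElt_of_ne fun h => hi.ne (Subtype.ext h)
  · exact ⟨ht, m, hm, by simp⟩

open Classical in
/-- The distribution of the tuples obtained from `t` by completing the coordinates in `I` in round
robin order, each new element being chosen generically with respect to `U`. -/
noncomputable def generic (hF : IsRegularThin F) (U : Ultrafilter ℕ) (I : Finset ℕ) :
    (ℕ → Finset ℕ) → Ultrafilter (ℕ → Finset ℕ) :=
  (hF.wellFounded_tupleStep I).fix fun t ih =>
    if h : ∃ j, IsNext F I t j then
      -- The test only justifies the recursive call: for `U` finer than `atTop` it succeeds for
      -- `U`-almost every `m`, and the default `pure t` is irrelevant.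
      U.bind fun m => if hs : TupleStep F I (addElt t h.choose m) t then ih _ hs else pure t
    else pure t

variable {hF : IsRegularThin F} {U : Ultrafilter ℕ}

lemma generic_of_not_active (h : ∀ j, ¬ IsActive F I t j) : generic hF U I t = pure t := by
  rw [generic, WellFounded.fix_eq, dif_neg]
  rintro ⟨j, hj⟩
  exact h j hj.1

lemma IsActive.eventually_tupleStep (hU : (U : Filter ℕ) ≤ atTop) (h : IsActive F I t j) :
    ∀ᶠ m in (U : Filter ℕ), TupleStep F I (addElt t j m) t := by
  have : ∀ᶠ m in (U : Filter ℕ), ∀ n ∈ t j, n < m :=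
    (eventually_all_finset _).2 fun n _ => hU (eventually_gt_atTop n)
  filter_upwards [this] with m hm
  exact ⟨j, h.1, m, h.2.1, hm, rfl⟩

lemma eventually_generic_of_isNext (hU : (U : Filter ℕ) ≤ atTop) (h : IsNext F I t j)
    {Q : (ℕ → Finset ℕ) → Prop} :
    (∀ᶠ s in (generic hF U I t : Filter _), Q s) ↔
      ∀ᶠ m in (U : Filter ℕ), ∀ᶠ s in (generic hF U I (addElt t j m) : Filter _), Q s := by
  have hex : ∃ j, IsNext F I t j := ⟨j, h⟩
  have hc : hex.choose = j := hex.choose_spec.unique h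
  rw [generic, WellFounded.fix_eq, dif_pos hex, hc]
  change (∀ᶠ s in Filter.bind (U : Filter ℕ) _, Q s) ↔ _
  rw [eventually_bind]
  refine eventually_congr ?_
  filter_upwards [h.1.eventually_tupleStep hU] with m hm
  rw [dif_pos hm]

/-- Induction along the construction. -/
lemma generic_induction (hF : IsRegularThin F) (hU : (U : Filter ℕ) ≤ atTop) (I : Finset ℕ)
    {P : (ℕ → Finset ℕ) → Prop}
    (done : ∀ t, (∀ j, ¬ IsActive F I t j) → P t)
    (step : ∀ t j, IsNext F I t j → (∀ᶠ m in (U : Filter ℕ), P (addElt t j m)) → P t) (t) : P t := by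
  induction t using (hF.wellFounded_tupleStep I).induction with
  | _ t ih =>
    by_cases h : ∃ j, IsActive F I t j
    · obtain ⟨j, hj⟩ := exists_isNext h
      exact step t j hj ((hj.1.eventually_tupleStep hU).mono fun m hm => ih _ hm)
    · exact done t (not_exists.1 h)

/-- Statements about the coordinates in `J` are inherited by larger sets of coordinates. -/
lemma eventually_generic_mono (hU : (U : Filter ℕ) ≤ atTop) (hJI : J ⊆ I)
    {Q : (ℕ → Finset ℕ) → Prop}
    (hQ : ∀ s s' : ℕ → Finset ℕ, (∀ i ∈ J, s i = s' i) → Q s → Q s') :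
    ∀ t t' : ℕ → Finset ℕ, (∀ i ∈ J, t i = t' i) →
      (∀ᶠ s in (generic hF U J t' : Filter _), Q s) →
      ∀ᶠ s in (generic hF U I t : Filter _), Q s := by
  intro t
  induction t using generic_induction hF hU I with
  | done t ht =>
    intro t' htt h
    rw [generic_of_not_active] at h ⊢
    · exact hQ t' t (fun i hi => (htt i hi).symm) h
    · exact ht
    · intro j hj
      exact ht j ⟨hJI hj.1, by simpa only [htt j hj.1] using hj.2⟩
  | step t j hj ih =>
    intro t' htt h
    rw [eventually_generic_of_isNext hU hj]
    -- Round robin order on `J` is inherited from `I`: a step at `j ∈ J` is also the next step for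
    -- `J`, and any other step is invisible there.
    by_cases hjJ : j ∈ J
    · have hj' : IsNext F J t' j := by
        refine ⟨⟨hjJ, by simpa only [htt j hjJ] using hj.1.2⟩, fun i hi => ?_⟩
        rw [← htt j hjJ, ← htt i hi.1]
        exact hj.2 i ⟨hJI hi.1, by simpa only [htt i hi.1] using hi.2⟩
      rw [eventually_generic_of_isNext hU hj'] at h
      filter_upwards [ih, h] with m hm hm'
      refine hm _ (fun i hi => ?_) hm'
      by_cases hij : i = j
      · subst hij; simp [htt i hi]
      · rw [addElt_of_ne hij, addElt_of_ne hij, htt i hi]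
    · filter_upwards [ih] with m hm
      refine hm t' (fun i hi => ?_) h
      rw [addElt_of_ne (ne_of_mem_of_not_mem hi hjJ), htt i hi]

end FSpreading

namespace FSpreading

variable {F : Set (Finset ℕ)} {I J : Finset ℕ} {t t' s : ℕ → Finset ℕ} {i j m : ℕ}
  {hF : IsRegularThin F} {U : Ultrafilter ℕ} {L M : Set ℕ}

/-! ### Plegma families and indices -/

/-- The index of `n` in the increasing enumeration of `s`. -/
def idx (s : Finset ℕ) (n : ℕ) : ℕ := (s.filter (· < n)).card

lemma idx_eq_count (s : Finset ℕ) (n : ℕ) : idx s n = Nat.count (fun k => k ∈ (s : Set ℕ)) n := by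
  rw [Nat.count_eq_card_filter_range, idx]
  congr 1
  ext k
  simp [and_comm]

lemma elt_idx {s : Finset ℕ} {n : ℕ} (h : n ∈ s) : elt s (idx s n) = n := by
  rw [idx_eq_count, elt]
  exact Nat.nth_count (p := fun k => k ∈ (s : Set ℕ)) (by simpa using h)

lemma idx_lt_card {s : Finset ℕ} {n : ℕ} (h : n ∈ s) : idx s n < s.card :=
  Finset.card_lt_card (Finset.filter_ssubset.2 ⟨n, h, lt_irrefl n⟩)

lemma idx_mono (s : Finset ℕ) : Monotone (idx s) := fun _ _ h =>
  Finset.card_le_card (Finset.monotone_filter_right s fun _ _ hk => lt_of_lt_of_le hk h)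

lemma elt_spec {s : Finset ℕ} {r : ℕ} (h : r < s.card) : elt s r ∈ s ∧ idx s (elt s r) = r := by
  have hfin : (Set.ofPred fun k => k ∈ (s : Set ℕ)).Finite := s.finite_toSet
  have hc : r < hfin.toFinset.card := by
    convert h
    ext k
    simp
  refine ⟨by simpa [elt] using Nat.nth_mem_of_lt_card hfin hc, ?_⟩
  rw [idx_eq_count]
  exact Nat.count_nth fun _ => by convert hc

lemma elt_lt_elt {s : Finset ℕ} {q r : ℕ} (hqr : q < r) (h : r < s.card) : elt s q < elt s r := by
  by_contra! h'
  have := idx_mono s h'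
  rw [(elt_spec h).2, (elt_spec (hqr.trans h)).2] at this
  omega

lemma elt_le_elt {s : Finset ℕ} {q r : ℕ} (hqr : q ≤ r) (h : r < s.card) : elt s q ≤ elt s r := by
  rcases hqr.eq_or_lt with rfl | h'
  · rfl
  · exact (elt_lt_elt h' h).le

lemma idx_insert {s : Finset ℕ} {n : ℕ} (hn : n ≤ m) :
    idx (insert m s) n = idx s n := by
  rw [idx, idx, Finset.filter_insert, if_neg (by omega)]

lemma idx_of_forall_lt {s : Finset ℕ} (hm : ∀ n ∈ s, n < m) : idx s m = s.card := by
  rw [idx, Finset.filter_true_of_mem hm]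

/-- The plegma inequalities for the members of `s` with index in `I`. -/
structure PlegmaOn (I : Finset ℕ) (s : ℕ → Finset ℕ) : Prop where
  lt_of_idx_lt : ∀ i ∈ I, ∀ j ∈ I, ∀ n ∈ s i, ∀ m ∈ s j, idx (s i) n < idx (s j) m → n < m
  lt_of_idx_eq : ∀ i ∈ I, ∀ j ∈ I, i < j → ∀ n ∈ s i, ∀ m ∈ s j, idx (s i) n = idx (s j) m → n < m

lemma PlegmaOn.isPlegma {κ : ℕ → ℕ} {l : ℕ} (h : PlegmaOn I s) (hκ : StrictMono κ)
    (hI : ∀ i < l, κ i ∈ I) (hne : ∀ i ∈ I, (s i).Nonempty) :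
    IsPlegma fun i : Fin l => s (κ i) where
  nonempty i := hne _ (hI i i.2)
  lt_same i j hij k hi hj :=
    h.lt_of_idx_eq _ (hI i i.2) _ (hI j j.2) (hκ hij) _ (elt_spec hi).1 _ (elt_spec hj).1
      ((elt_spec hi).2.trans (elt_spec hj).2.symm)
  lt_succ i j k hi hj :=
    h.lt_of_idx_lt _ (hI i i.2) _ (hI j j.2) _ (elt_spec hi).1 _ (elt_spec hj).1
      (by rw [(elt_spec hi).2, (elt_spec hj).2]; omega)

/-- The definition compares consecutive indices only; larger gaps follow because the enumeration of
each member increases. -/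
lemma IsPlegma.plegmaOn {l : ℕ} (h : IsPlegma fun i : Fin l => s i) :
    PlegmaOn (Finset.range l) s where
  lt_of_idx_lt i hi j hj n hn m hm hlt := by
    rw [Finset.mem_range] at hi hj
    have hm' := idx_lt_card hm
    have := h.lt_succ ⟨i, hi⟩ ⟨j, hj⟩ _ (idx_lt_card hn) (by dsimp only at *; omega)
    rw [elt_idx hn] at this
    refine this.trans_le ?_
    conv_rhs => rw [← elt_idx hm]
    exact elt_le_elt hlt hm'
  lt_of_idx_eq i hi j hj hij n hn m hm heq := by
    rw [Finset.mem_range] at hi hj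
    have hm' := idx_lt_card hm
    have := h.lt_same ⟨i, hi⟩ ⟨j, hj⟩ hij _ (idx_lt_card hn) (by dsimp only at *; omega)
    rw [elt_idx hn] at this
    rwa [heq, elt_idx hm] at this

/-! ### Generic tuples are plegma -/

/-- The states of the round robin construction starting from the empty tuple. -/
structure IsState (F : Set (Finset ℕ)) (M : Set ℕ) (N : ℕ) (I : Finset ℕ) (t : ℕ → Finset ℕ) :
    Prop where
  mem_hat : ∀ i ∈ I, t i ∈ hat F
  subset : ∀ i ∈ I, (t i : Set ℕ) ⊆ M
  le : ∀ i ∈ I, ∀ n ∈ t i, N ≤ n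
  plegmaOn : PlegmaOn I t
  card_le_succ : ∀ j, IsActive F I t j → ∀ i ∈ I, (t i).card ≤ (t j).card + 1
  card_le : ∀ j, IsActive F I t j → ∀ i ∈ I, j < i → (t i).card ≤ (t j).card

lemma isState_empty (hne : F.Nonempty) (N : ℕ) : IsState F M N I fun _ => ∅ := by
  refine ⟨fun _ _ => empty_mem_hat hne, ?_, ?_, ⟨?_, ?_⟩, ?_, ?_⟩ <;> simp

/-- The new element exceeds all earlier ones and has index `(t j).card`. A plegma inequality could
fail only against an old element of larger index, or of equal index at a coordinate after `j`; the
two cardinality bounds exclude both. -/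
lemma IsState.addElt {N : ℕ} (h : IsState F M N I t) (hj : IsNext F I t j)
    (hm : ∀ i ∈ I, ∀ n ∈ t i, n < m) (hmM : m ∈ M) (hmN : N ≤ m) (hmF : insert m (t j) ∈ hat F) :
    IsState F M N I (addElt t j m) := by
  have hjI := hj.1.1
  have hcard : (insert m (t j)).card = (t j).card + 1 :=
    Finset.card_insert_of_notMem fun h => lt_irrefl _ (hm j hjI m h)
  -- old elements keep their index, and the new one is the last of its set
  have hidx : ∀ i ∈ I, ∀ n ∈ FSpreading.addElt t j m i,
      n ∈ t i ∧ n < m ∧ idx (FSpreading.addElt t j m i) n = idx (t i) n ∧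
        idx (t i) n < (t i).card ∨
      i = j ∧ n = m ∧ idx (FSpreading.addElt t j m i) n = (t j).card := by
    intro i hi n hn
    by_cases hij : i = j
    · subst hij
      rw [addElt_self] at hn ⊢
      rcases Finset.mem_insert.1 hn with rfl | hn
      · right
        exact ⟨rfl, rfl, by rw [idx_insert le_rfl, idx_of_forall_lt (hm i hi)]⟩
      · left
        exact ⟨hn, hm i hi n hn, idx_insert (hm i hi n hn).le, idx_lt_card hn⟩
    · rw [addElt_of_ne hij] at hn ⊢
      exact .inl ⟨hn, hm i hi n hn, rfl, idx_lt_card hn⟩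
  have hact : ∀ i, IsActive F I (FSpreading.addElt t j m) i → i = j ∨ i ≠ j ∧ IsActive F I t i := by
    intro i hi
    by_cases hij : i = j
    · exact .inl hij
    · right
      rw [IsActive, addElt_of_ne hij] at hi
      exact ⟨hij, hi⟩
  refine ⟨fun i hi => ?_, fun i hi => ?_, fun i hi => ?_, ⟨?_, ?_⟩, ?_, ?_⟩
  · by_cases hij : i = j
    · subst hij; simpa using hmF
    · rw [addElt_of_ne hij]; exact h.mem_hat i hi
  · by_cases hij : i = j
    · subst hij; simpa [Set.insert_subset_iff] using ⟨hmM, h.subset i hi⟩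
    · rw [addElt_of_ne hij]; exact h.subset i hi
  · by_cases hij : i = j
    · subst hij; simpa using ⟨hmN, h.le i hi⟩
    · rw [addElt_of_ne hij]; exact h.le i hi
  · intro a ha b hb n hn p hp hlt
    rcases hidx a ha n hn with ⟨h1, h2, h3, h4⟩ | ⟨rfl, rfl, h3⟩ <;>
    rcases hidx b hb p hp with ⟨k1, k2, k3, k4⟩ | ⟨rfl, rfl, k3⟩
    · exact h.plegmaOn.lt_of_idx_lt a ha b hb n h1 p k1 (by omega)
    · exact h2
    · have := h.card_le_succ a hj.1 b hb
      omega
    · omega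
  · intro a ha b hb hab n hn p hp heq
    rcases hidx a ha n hn with ⟨h1, h2, h3, h4⟩ | ⟨rfl, rfl, h3⟩ <;>
    rcases hidx b hb p hp with ⟨k1, k2, k3, k4⟩ | ⟨rfl, rfl, k3⟩
    · exact h.plegmaOn.lt_of_idx_eq a ha b hb hab n h1 p k1 (by omega)
    · exact h2
    · have := h.card_le a hj.1 b hb hab
      omega
    · omega
  · intro a ha b hb
    rcases hact a ha with rfl | ⟨haj, ha'⟩
    · rw [addElt_self, hcard]
      by_cases hba : b = a
      · subst hba; rw [addElt_self, hcard]; omega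
      · rw [addElt_of_ne hba]
        have := h.card_le_succ a hj.1 b hb
        omega
    · rw [addElt_of_ne haj]
      by_cases hbj : b = j
      · subst hbj
        rw [addElt_self, hcard]
        have := hj.2 a ha'
        omega
      · rw [addElt_of_ne hbj]
        exact h.card_le_succ a ha' b hb
  · intro a ha b hb hab
    rcases hact a ha with rfl | ⟨haj, ha'⟩
    · rw [addElt_self, hcard, addElt_of_ne hab.ne']
      have := h.card_le a hj.1 b hb hab
      omega
    · rw [addElt_of_ne haj]
      by_cases hbj : b = j
      · subst hbj
        rw [addElt_self, hcard]
        have := hj.2 a ha'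
        omega
      · rw [addElt_of_ne hbj]
        exact h.card_le a ha' b hb hab

lemma IsState.eventually_addElt {N : ℕ} (hF : IsRegularThin F) (hU : (U : Filter ℕ) ≤ atTop)
    (hM : M ∈ U) (h : IsState F M N I t) (hj : IsNext F I t j) :
    ∀ᶠ m in (U : Filter ℕ), IsState F M N I (FSpreading.addElt t j m) := by
  have h1 : ∀ᶠ m in (U : Filter ℕ), ∀ i ∈ I, ∀ n ∈ t i, n < m :=
    (eventually_all_finset _).2 fun i _ => (eventually_all_finset _).2 fun n _ =>
      hU (eventually_gt_atTop n)
  filter_upwards [h1, hM, hU (eventually_ge_atTop N),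
    hU (hF.eventually_insert_mem_hat hj.1.2.1 hj.1.2.2)] with m h1 h2 h3 h4
  exact h.addElt hj h1 h2 h3 h4

lemma IsState.eventually_generic {N : ℕ} (hU : (U : Filter ℕ) ≤ atTop) (hM : M ∈ U) :
    ∀ t, IsState F M N I t → ∀ᶠ s in (generic hF U I t : Filter _),
      IsState F M N I s ∧ ∀ i ∈ I, s i ∈ F := by
  intro t
  induction t using generic_induction hF hU I with
  | done t ht =>
    intro h
    rw [generic_of_not_active ht]
    exact ⟨h, fun i hi => by_contra fun hc => ht i ⟨hi, h.mem_hat i hi, hc⟩⟩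
  | step t j hj ih =>
    intro h
    rw [eventually_generic_of_isNext hU hj]
    filter_upwards [ih, h.eventually_addElt hF hU hM hj] with m h1 h2
    exact h1 h2

/-- A tuple of members of `F` within `M` and beyond `N`, satisfying the plegma inequalities. -/
structure IsGood (F : Set (Finset ℕ)) (M : Set ℕ) (N : ℕ) (I : Finset ℕ) (s : ℕ → Finset ℕ) :
    Prop where
  mem : ∀ i ∈ I, s i ∈ restrict F M
  le : ∀ i ∈ I, ∀ n ∈ s i, N ≤ n
  plegmaOn : PlegmaOn I s

lemma IsGood.mono {N : ℕ} (h : IsGood F M N I s) (hJ : J ⊆ I) : IsGood F M N J s :=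
  ⟨fun i hi => h.mem i (hJ hi), fun i hi => h.le i (hJ hi),
    ⟨fun i hi j hj => h.plegmaOn.lt_of_idx_lt i (hJ hi) j (hJ hj),
      fun i hi j hj => h.plegmaOn.lt_of_idx_eq i (hJ hi) j (hJ hj)⟩⟩

lemma eventually_generic_isGood (hne : F.Nonempty) (hU : (U : Filter ℕ) ≤ atTop) (hM : M ∈ U)
    (N : ℕ) (I : Finset ℕ) :
    ∀ᶠ s in (generic hF U I fun _ => ∅ : Filter _), IsGood F M N I s :=
  (IsState.eventually_generic hU hM _ (isState_empty hne N)).mono fun _ hs =>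
    ⟨fun i hi => ⟨hs.2 i hi, hs.1.subset i hi⟩, hs.1.le, hs.1.plegmaOn⟩

/-- The distribution of an infinite sequence of members of `F`, any finitely many of which are
generic. -/
noncomputable def genericSeq (hF : IsRegularThin F) (U : Ultrafilter ℕ) :
    Ultrafilter (ℕ → Finset ℕ) :=
  (hyperfilter ℕ).bind fun n => generic hF U (Finset.range n) fun _ => ∅

lemma eventually_genericSeq {Q : (ℕ → Finset ℕ) → Prop} :
    (∀ᶠ s in (genericSeq hF U : Filter _), Q s) ↔ ∀ᶠ n in (hyperfilter ℕ : Filter ℕ),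
      ∀ᶠ s in (generic hF U (Finset.range n) fun _ => ∅ : Filter _), Q s := by
  change (∀ᶠ s in Filter.bind (hyperfilter ℕ : Filter ℕ) _, Q s) ↔ _
  rw [eventually_bind]

lemma eventually_hyperfilter_ge (n : ℕ) : ∀ᶠ k in (hyperfilter ℕ : Filter ℕ), n ≤ k :=
  Nat.hyperfilter_le_atTop (eventually_ge_atTop n)

lemma eventually_genericSeq_isGood (hne : F.Nonempty) (hU : (U : Filter ℕ) ≤ atTop) (hM : M ∈ U)
    (N : ℕ) (n : ℕ) :
    ∀ᶠ s in (genericSeq hF U : Filter _), IsGood F M N (Finset.range n) s := by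
  rw [eventually_genericSeq]
  filter_upwards [eventually_hyperfilter_ge n] with k hk
  filter_upwards [eventually_generic_isGood hne hU hM N (Finset.range k)] with s hs
  exact hs.mono (by simpa using hk)

/-- A property of the first `n` members which is generic in `genericSeq` is generic for
`n`-tuples. -/
lemma eventually_generic_of_genericSeq (hU : (U : Filter ℕ) ≤ atTop) {n : ℕ}
    {Q : (ℕ → Finset ℕ) → Prop}
    (hQ : ∀ s s' : ℕ → Finset ℕ, (∀ i ∈ Finset.range n, s i = s' i) → Q s → Q s')
    (h : ∀ᶠ s in (genericSeq hF U : Filter _), Q s) :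
    ∀ᶠ s in (generic hF U (Finset.range n) fun _ => ∅ : Filter _), Q s := by
  by_contra hc
  -- An ultrafilter decides `Q`. A generic negation would pass to all longer tuples, hence to
  -- `genericSeq`.
  rw [← Ultrafilter.eventually_not] at hc
  have : ∀ᶠ s in (genericSeq hF U : Filter _), ¬ Q s := by
    rw [eventually_genericSeq]
    filter_upwards [eventually_hyperfilter_ge n] with k hk
    exact eventually_generic_mono hU (by simpa using hk)
      (fun s s' hss hs hs' => hs (hQ s' s (fun i hi => (hss i hi).symm) hs')) _ _
      (fun _ _ => rfl) hc
  obtain ⟨s, h1, h2⟩ := (h.and this).exists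
  exact h2 h1

end FSpreading

namespace FSpreading

variable {F : Set (Finset ℕ)} {I J : Finset ℕ} {t t' s : ℕ → Finset ℕ} {i j m : ℕ}
  {hF : IsRegularThin F} {U : Ultrafilter ℕ} {L M : Set ℕ}

/-! ### Diagonalization -/

/-- The part of the tuple `s` below `N`. -/
def below (s : ℕ → Finset ℕ) (N : ℕ) : ℕ → Finset ℕ := fun i => (s i).filter (· < N)

lemma below_zero : below s 0 = fun _ => ∅ := by
  funext i
  simp [below]

lemma below_succ_of_mem (hj : j ∈ I) {N : ℕ} (hN : N ∈ s j) (hI : ∀ i ∉ I, s i = ∅)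
    (h : ∀ i ∈ I, N ∈ s i → i = j) : below s (N + 1) = addElt (below s N) j N := by
  funext i
  by_cases hij : i = j
  · subst hij
    ext n
    simp only [below, addElt_self, Finset.mem_filter, Finset.mem_insert]
    constructor
    · rintro ⟨h1, h2⟩
      rcases Nat.lt_succ_iff_lt_or_eq.1 h2 with h3 | h3
      · exact .inr ⟨h1, h3⟩
      · exact .inl h3
    · rintro (rfl | ⟨h1, h2⟩)
      · exact ⟨hN, by omega⟩
      · exact ⟨h1, by omega⟩
  · rw [addElt_of_ne hij]
    ext n
    simp only [below, Finset.mem_filter, and_congr_right_iff]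
    intro hn
    have : n ≠ N := by
      rintro rfl
      by_cases hi : i ∈ I
      · exact hij (h i hi hn)
      · simp [hI i hi] at hn
    omega

lemma below_succ_of_notMem {N : ℕ} (h : ∀ i, N ∉ s i) : below s (N + 1) = below s N := by
  funext i
  ext n
  simp only [below, Finset.mem_filter, and_congr_right_iff]
  intro hn
  have : n ≠ N := by
    rintro rfl
    exact h i hn
  omega

lemma mem_hat_of_subset (hF : IsRegularThin F) {s t : Finset ℕ} (hs : s ∈ F) (h : t ⊆ s) :
    t ∈ hat F := hF.regular.hereditary s (subset_hat hs) t h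

/-- An unfinished coordinate of `below s N` has an element of `s` beyond `N` to come. -/
lemma exists_ge_of_isActive_below (hs : ∀ i ∈ I, s i ∈ F) {N : ℕ}
    (hj : IsActive F I (below s N) j) :
    ∃ p ∈ s j, N ≤ p ∧ idx (s j) p = (below s N j).card := by
  have hex : ∃ p, p ∈ s j ∧ N ≤ p := by
    by_contra! h
    refine hj.2.2 ?_
    rw [below, Finset.filter_true_of_mem fun n hn => h n hn]
    exact hs j hj.1
  classical
  refine ⟨Nat.find hex, (Nat.find_spec hex).1, (Nat.find_spec hex).2, ?_⟩
  rw [idx, below]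
  congr 1
  ext n
  simp only [Finset.mem_filter, and_congr_right_iff]
  intro hn
  have h1 := (Nat.find_spec hex).2
  constructor
  · intro h
    by_contra! h'
    exact Nat.find_min hex h ⟨hn, h'⟩
  · intro h
    omega

/-- Listing the elements of a plegma family in increasing order replays the round robin
construction. An active coordinate preceding `j` in that order would have its next element at or
beyond `N`, while the plegma inequalities put it below `N`. Thinness ensures that `j` itself is
still unfinished. -/
lemma PlegmaOn.isNext_below (hF : IsRegularThin F) (h : PlegmaOn I s) (hs : ∀ i ∈ I, s i ∈ F)
    {N : ℕ} (hj : j ∈ I) (hN : N ∈ s j) : IsNext F I (below s N) j := by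
  refine ⟨⟨hj, mem_hat_of_subset hF (hs j hj) (Finset.filter_subset _ _), fun hc => ?_⟩,
    fun i hi => ?_⟩
  · have := hF.thin _ hc _ (hs j hj) ⟨Finset.filter_subset _ _, fun m hm hm' n hn => by
      simp only [below, Finset.mem_filter, hm, true_and] at hm' hn
      omega⟩
    rw [← this] at hN
    simp [below] at hN
  · obtain ⟨p, hp, hNp, hidx⟩ := exists_ge_of_isActive_below hs hi
    have hNidx : idx (s j) N = (below s N j).card := rfl
    rw [← hidx, ← hNidx]
    by_contra! hc
    rcases hc.1.lt_or_eq with hlt | heq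
    · have := h.lt_of_idx_lt i hi.1 j hj p hp N hN hlt
      omega
    · have := h.lt_of_idx_eq i hi.1 j hj (hc.2 heq.symm) p hp N hN heq
      omega

lemma PlegmaOn.eq_of_mem (hF : IsRegularThin F) (h : PlegmaOn I s) (hs : ∀ i ∈ I, s i ∈ F)
    {N : ℕ} (hi : i ∈ I) (hNi : N ∈ s i) (hj : j ∈ I) (hNj : N ∈ s j) : i = j :=
  (h.isNext_below hF hs hi hNi).unique (h.isNext_below hF hs hj hNj)

lemma finite_tuples (B : Finset ℕ) (k : ℕ) :
    {t : ℕ → Finset ℕ | (∀ i, t i ⊆ B) ∧ ∀ i, k < i → t i = ∅}.Finite := by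
  refine ((Fintype.piFinset fun _ : Fin (k + 1) => B.powerset).finite_toSet.image
    fun f i => if h : i < k + 1 then f ⟨i, h⟩ else ∅).subset ?_
  rintro t ⟨h1, h2⟩
  refine ⟨fun i => t i, by simp [h1], ?_⟩
  funext i
  by_cases hi : i < k + 1
  · simp [hi]
  · simp [hi, h2 i (by omega)]

lemma elt_range_of_strictMono {f : ℕ → ℕ} (hf : StrictMono f) (l : ℕ) :
    elt (Set.range f) l = f l := by
  have hinf : (Set.ofPred fun n => n ∈ Set.range f).Infinite :=
    Set.infinite_range_of_injective hf.injective
  have h := (Nat.nth_strictMono hinf).range_inj hf |>.1 ?_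
  · exact congrFun h l
  · rw [Nat.range_nth_of_infinite hinf]
    rfl

/-- Recursive choice in which each term may depend on the set of earlier terms. -/
lemma exists_finset_seq (P : Finset ℕ → ℕ → Prop) (hP : ∀ B, ∃ m, P B m) :
    ∃ f : ℕ → ℕ, ∀ n, P ((Finset.range n).image f) (f n) := by
  choose g hg using hP
  let B : ℕ → Finset ℕ := fun n => Nat.rec ∅ (fun _ B => insert (g B) B) n
  have hB : ∀ n, B n = (Finset.range n).image fun n => g (B n) := fun n => by
    induction n with
    | zero => simp [B]
    | succ n ih =>
      rw [Finset.range_add_one, Finset.image_insert, ← ih]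
  exact ⟨fun n => g (B n), fun n => by rw [← hB]; exact hg _⟩

/-- Generic properties of tuples hold for all plegma families in some infinite set. -/
lemma exists_subset_forall_plegma (hU : (U : Filter ℕ) ≤ atTop) (hL : L ∈ U)
    (S : ℕ → ℕ → Set (ℕ → Finset ℕ))
    (hS : ∀ l k, k ≤ l → ∀ᶠ s in (generic hF U (Finset.range (k + 1)) fun _ => ∅ : Filter _),
      s ∈ S l k) :
    ∃ M ⊆ L, M.Infinite ∧ ∀ l k, k ≤ l → ∀ s : ℕ → Finset ℕ, (∀ i ≤ k, s i ∈ restrict F M) →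
      (∀ i, k < i → s i = ∅) → IsPlegma (fun i : Fin (k + 1) => s i) →
      (∀ n ∈ s 0, elt M l ≤ n) → s ∈ S l k := by
  -- An admissible `m` preserves genericity of `S l k` at every state formed from the earlier
  -- elements `B`, for `l ≤ B.card`. These are finitely many conditions, so `U`-almost every `m`
  -- satisfies them.
  let P : Finset ℕ → ℕ → Prop := fun B m => m ∈ L ∧ (∀ b ∈ B, b < m) ∧
    ∀ l ∈ Finset.range (B.card + 1), ∀ k ∈ Finset.range (l + 1),
      ∀ t ∈ {t : ℕ → Finset ℕ | (∀ i, t i ⊆ B) ∧ ∀ i, k < i → t i = ∅},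
      ∀ j ∈ Finset.range (k + 1), IsNext F (Finset.range (k + 1)) t j →
        (∀ᶠ s in (generic hF U (Finset.range (k + 1)) t : Filter _), s ∈ S l k) →
        ∀ᶠ s in (generic hF U (Finset.range (k + 1)) (addElt t j m) : Filter _), s ∈ S l k
  have hP : ∀ B, ∃ m, P B m := fun B => by
    have : ∀ᶠ m in (U : Filter ℕ), P B m := by
      refine Filter.Eventually.and hL (.and ?_ ?_)
      · exact (eventually_all_finset _).2 fun b _ => hU (eventually_gt_atTop b)
      · refine (eventually_all_finset _).2 fun l _ => (eventually_all_finset _).2 fun k _ =>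
          (eventually_all_finite (finite_tuples B k)).2 fun t _ =>
          (eventually_all_finset _).2 fun j _ => ?_
        simp only [eventually_imp_distrib_left]
        exact fun hj h => (eventually_generic_of_isNext hU hj).1 h
    exact this.exists
  obtain ⟨f, hf⟩ := exists_finset_seq P hP
  have hmono : StrictMono f := strictMono_nat_of_lt_succ fun n =>
    (hf (n + 1)).2.1 _ (Finset.mem_image_of_mem _ (by simp))
  refine ⟨Set.range f, Set.range_subset_iff.2 fun n => (hf n).1,
    Set.infinite_range_of_injective hmono.injective, ?_⟩
  intro l k hkl s hs hs0 hpl hmin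
  rw [elt_range_of_strictMono hmono] at hmin
  have hpl' := hpl.plegmaOn
  have hsF : ∀ i ∈ Finset.range (k + 1), s i ∈ F := fun i hi =>
    (hs i (by simpa [Nat.lt_succ_iff] using hi)).1
  have hge : ∀ i ∈ Finset.range (k + 1), ∀ n ∈ s i, f l ≤ n := by
    intro i hi n hn
    rcases Nat.eq_zero_or_pos i with rfl | hi0
    · exact hmin n hn
    have hc : 0 < (s 0).card := Finset.card_pos.2 (hpl.nonempty 0)
    obtain ⟨hp, hp'⟩ := elt_spec hc
    refine (hmin _ hp).trans (le_of_lt ?_)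
    rcases Nat.eq_zero_or_pos (idx (s i) n) with h | h
    · exact hpl'.lt_of_idx_eq 0 (by simp) i hi hi0 _ hp n hn (by omega)
    · exact hpl'.lt_of_idx_lt 0 (by simp) i hi _ hp n hn (by omega)
  have hsM : ∀ i ∈ Finset.range (k + 1), (s i : Set ℕ) ⊆ Set.range f := fun i hi =>
    (hs i (by simpa [Nat.lt_succ_iff] using hi)).2
  have hI : ∀ i ∉ Finset.range (k + 1), s i = ∅ := fun i hi =>
    hs0 i (by simpa [Nat.lt_succ_iff] using hi)
  -- Genericity survives the replay of `s` element by element; once `s` is complete the distribution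
  -- is `pure s`.
  have key : ∀ N, ∀ᶠ s in (generic hF U (Finset.range (k + 1)) (below s N) : Filter _),
      s ∈ S l k := by
    intro N
    induction N with
    | zero => rw [below_zero]; exact hS l k hkl
    | succ N ih =>
      by_cases hN : ∃ j ∈ Finset.range (k + 1), N ∈ s j
      · obtain ⟨j, hj, hNj⟩ := hN
        rw [below_succ_of_mem hj hNj hI fun i hi hNi => hpl'.eq_of_mem hF hsF hi hNi hj hNj]
        obtain ⟨n, rfl⟩ := hsM j hj hNj
        -- All elements of `s` lie beyond `f l`, so the condition for `l` was already imposed when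
        -- `f n` was chosen.
        have hln : l ≤ n := hmono.le_iff_le.1 (hge j hj _ hNj)
        refine (hf n).2.2 l ?_ k (by simpa [Nat.lt_succ_iff] using hkl) _ ⟨fun i => ?_, fun i hi => ?_⟩ j hj
          (hpl'.isNext_below hF hsF hj hNj) ih
        · rw [Finset.card_image_of_injective _ hmono.injective]
          simpa [Nat.lt_succ_iff] using hln
        · intro p hp
          simp only [below, Finset.mem_filter] at hp
          by_cases hi : i ∈ Finset.range (k + 1)
          · obtain ⟨q, rfl⟩ := hsM i hi hp.1
            exact Finset.mem_image_of_mem _ (by simpa using hmono.lt_iff_lt.1 hp.2)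
          · simp [hI i hi] at hp
        · simp [below, hs0 i hi]
      · rw [below_succ_of_notMem]
        · exact ih
        · intro i hi
          by_cases hik : i ∈ Finset.range (k + 1)
          · exact hN ⟨i, hik, hi⟩
          · simp [hI i hik] at hi
  obtain ⟨N, hN⟩ : ∃ N, below s N = s := by
    refine ⟨(((Finset.range (k + 1)).biUnion s).sup id) + 1, ?_⟩
    funext i
    rw [below, Finset.filter_true_of_mem]
    intro n hn
    by_cases hi : i ∈ Finset.range (k + 1)
    · exact Nat.lt_succ_iff.2 (Finset.le_sup (f := id) (Finset.mem_biUnion.2 ⟨i, hi, hn⟩))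
    · simp [hI i hi] at hn
  have := key N
  rw [hN, generic_of_not_active fun j hj => hj.2.2 (hsF j hj.1)] at this
  exact this

end FSpreading

namespace FSpreading

variable {F : Set (Finset ℕ)} {I J : Finset ℕ} {t t' s : ℕ → Finset ℕ} {i j m : ℕ}
  {hF : IsRegularThin F} {U : Ultrafilter ℕ} {L M : Set ℕ}
  {X : Type*} [NormedAddCommGroup X] [NormedSpace ℝ X]
  {E : Type*} [SeminormedAddCommGroup E] [NormedSpace ℝ E]

/-! ### Limits along generic sequences -/

local notation "Λ" => Finsupp.linearCombination ℝ

lemma linearCombination_eq_sum_range {V : Type*} [AddCommGroup V] [Module ℝ V] (v : ℕ → V)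
    {a : ℕ →₀ ℝ} {n : ℕ} (h : a.support ⊆ Finset.range n) :
    Λ v a = ∑ i ∈ Finset.range n, a i • v i := by
  rw [Finsupp.linearCombination_apply, Finsupp.sum_of_support_subset _ h]
  simp

lemma linearCombination_congr_on {V : Type*} [AddCommGroup V] [Module ℝ V] {v v' : ℕ → V}
    {a : ℕ →₀ ℝ} (h : ∀ i ∈ a.support, v i = v' i) : Λ v a = Λ v' a := by
  rw [Finsupp.linearCombination_apply, Finsupp.linearCombination_apply]
  exact Finsupp.sum_congr fun i hi => by rw [h i hi]

lemma exists_support_subset_range (a : ℕ →₀ ℝ) : ∃ n, a.support ⊆ Finset.range (n + 1) :=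
  ⟨a.support.sup id, fun _ hi =>
    Finset.mem_range.2 (Nat.lt_succ_iff.2 (Finset.le_sup (f := id) hi))⟩

lemma norm_linearCombination_eq_mul {V : Type*} [SeminormedAddCommGroup V] [NormedSpace ℝ V]
    (v : ℕ → V) {a : ℕ →₀ ℝ} {k : ℕ} (hk : a.support ⊆ Finset.range k) {c : ℝ} (hc : 0 < c) :
    ‖Λ v a‖ = c * ‖∑ i : Fin k, (c⁻¹ * a i) • v i‖ := by
  rw [linearCombination_eq_sum_range v hk, Finset.sum_range]
  simp_rw [mul_smul, ← Finset.smul_sum]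
  rw [norm_smul, Real.norm_of_nonneg (by positivity), mul_inv_cancel_left₀ hc.ne']

/-- The norm estimate in the definition of a spreading model. -/
def Approximates (F : Set (Finset ℕ)) (M : Set ℕ) (x : Finset ℕ → X) (e : ℕ → E) : Prop :=
  ∃ δ : ℕ → ℝ, (∀ l, 0 < δ l) ∧ Tendsto δ atTop (𝓝 0) ∧
    ∀ l k : ℕ, k ≤ l → ∀ a : Fin (k + 1) → ℝ, (∀ i, a i ∈ Set.Icc (-1 : ℝ) 1) →
      ∀ s : Fin (k + 1) → Finset ℕ, (∀ i, s i ∈ restrict F M) → IsPlegma s →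
        (∀ n ∈ s 0, elt M l ≤ n) →
          |‖∑ i, a i • x (s i)‖ - ‖∑ i, a i • e (i : ℕ)‖| ≤ δ l

/-- Along `𝒢`, the initial parts of the sequences are plegma families in `restrict F M`, arbitrarily
far out. -/
def IsPlegmaFilter (F : Set (Finset ℕ)) (M : Set ℕ) (𝒢 : Filter (ℕ → Finset ℕ)) : Prop :=
  ∀ n N, ∀ᶠ s in 𝒢, IsPlegma (fun i : Fin n => s i) ∧ (∀ i < n, s i ∈ restrict F M) ∧
    ∀ i < n, ∀ p ∈ s i, N ≤ p

lemma Approximates.tendsto {x : Finset ℕ → X} {e : ℕ → E} (h : Approximates F M x e)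
    {𝒢 : Filter (ℕ → Finset ℕ)} (h𝒢 : IsPlegmaFilter F M 𝒢) (a : ℕ →₀ ℝ) :
    Tendsto (fun s => ‖Λ (x ∘ s) a‖) 𝒢 (𝓝 ‖Λ e a‖) := by
  obtain ⟨δ, -, hδ, hx⟩ := h
  obtain ⟨k, hk⟩ := exists_support_subset_range a
  -- Dividing by `c` brings the coefficients into `[-1, 1]`; the summand `1` keeps `c` positive.
  set c : ℝ := 1 + ∑ i ∈ a.support, |a i| with hc
  have hc0 : 0 < c := by positivity
  have hac : ∀ i, |a i| ≤ c := fun i => by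
    by_cases hi : i ∈ a.support
    · have := Finset.single_le_sum (f := fun i => |a i|) (fun i _ => abs_nonneg _) hi
      linarith
    · rw [Finsupp.notMem_support_iff.1 hi, abs_zero]; exact hc0.le
  rw [Metric.tendsto_nhds]
  intro ε hε
  obtain ⟨l, hl, hkl⟩ : ∃ l, δ l < ε / c ∧ k ≤ l :=
    (((tendsto_order.1 hδ).2 (ε / c) (by positivity)).and (eventually_ge_atTop k)).exists
  filter_upwards [h𝒢 (k + 1) (elt M l)] with s ⟨h1, h2, h3⟩
  have := hx l k hkl (fun i => c⁻¹ * a i) (fun i => ?_) (fun i => s i) (fun i => h2 i i.2) h1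
    (h3 0 (by simp))
  · rw [Real.dist_eq, norm_linearCombination_eq_mul _ hk hc0,
      norm_linearCombination_eq_mul _ hk hc0, ← mul_sub, abs_mul, abs_of_pos hc0]
    calc _ ≤ c * δ l := mul_le_mul_of_nonneg_left this hc0.le
      _ < c * (ε / c) := by gcongr
      _ = ε := by field_simp
  · rw [Set.mem_Icc, ← abs_le, abs_mul, abs_inv, abs_of_pos hc0, inv_mul_le_iff₀ hc0, mul_one]
    exact hac _

/-- Thinning out by `κ` keeps generic sequences plegma, which is what makes every model spreading.
-/
lemma isPlegmaFilter_genericSeq (hF₁ : ∃ s ∈ F, s.Nonempty) (hU : (U : Filter ℕ) ≤ atTop)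
    (hM : M ∈ U) {κ : ℕ → ℕ} (hκ : StrictMono κ) :
    IsPlegmaFilter F M (Filter.map (fun (s : ℕ → Finset ℕ) i => s (κ i)) (genericSeq hF U)) := by
  intro n N
  rw [eventually_map]
  filter_upwards [eventually_genericSeq_isGood (hF := hF) (hF₁.imp fun _ h => h.1) hU hM N (κ n)]
    with s hs
  have hκn : ∀ i < n, κ i ∈ Finset.range (κ n) := fun i hi => Finset.mem_range.2 (hκ hi)
  exact ⟨hs.plegmaOn.isPlegma hκ hκn fun i hi => hF.thin.nonempty_of_mem hF₁ (hs.mem i hi).1,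
    fun i hi => hs.mem _ (hκn i hi), fun i hi => hs.le _ (hκn i hi)⟩

lemma exists_ultrafilter_mem (hM : M.Infinite) :
    ∃ U : Ultrafilter ℕ, (U : Filter ℕ) ≤ atTop ∧ M ∈ U := by
  have : (atTop ⊓ 𝓟 M : Filter ℕ).NeBot :=
    frequently_mem_iff_neBot.1 (Nat.frequently_atTop_iff_infinite.2 hM)
  have h := Ultrafilter.of_le (atTop ⊓ 𝓟 M)
  exact ⟨Ultrafilter.of (atTop ⊓ 𝓟 M), h.trans inf_le_left,
    (h.trans inf_le_right) (mem_principal_self M)⟩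

lemma Approximates.tendsto_genericSeq {x : Finset ℕ → X} {e : ℕ → E} (h : Approximates F M x e)
    (hF₁ : ∃ s ∈ F, s.Nonempty) (hU : (U : Filter ℕ) ≤ atTop) (hM : M ∈ U) (a : ℕ →₀ ℝ) :
    Tendsto (fun s => ‖Λ (x ∘ s) a‖) (genericSeq hF U) (𝓝 ‖Λ e a‖) :=
  h.tendsto (isPlegmaFilter_genericSeq hF₁ hU hM strictMono_id) a

/-- Generated sequences are spreading. -/
lemma Approximates.norm_comp_eq {x : Finset ℕ → X} {e : ℕ → E} (h : Approximates F M x e)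
    (hF : IsRegularThin F) (hF₁ : ∃ s ∈ F, s.Nonempty) (hM : M.Infinite) {κ : ℕ → ℕ}
    (hκ : StrictMono κ) (a : ℕ →₀ ℝ) : ‖Λ (e ∘ κ) a‖ = ‖Λ e a‖ := by
  obtain ⟨U, hU, hMU⟩ := exists_ultrafilter_mem hM
  have h1 := h.tendsto_genericSeq (hF := hF) hF₁ hU hMU (a.mapDomain κ)
  have h2 := h.tendsto (isPlegmaFilter_genericSeq (hF := hF) hF₁ hU hMU hκ) a
  rw [tendsto_map'_iff] at h2
  rw [← Finsupp.linearCombination_mapDomain]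
  refine tendsto_nhds_unique (h1.congr fun s => ?_) h2
  rw [Finsupp.linearCombination_mapDomain]
  rfl

lemma exists_strictMono_extend {n : ℕ} {k : Fin n → ℕ} (hk : StrictMono k) :
    ∃ κ : ℕ → ℕ, StrictMono κ ∧ ∀ i : Fin n, κ i = k i := by
  -- Adding the sum of all `k j` puts the later values above the given ones.
  refine ⟨fun i => if h : i < n then k ⟨i, h⟩ else i + ∑ j, k j, fun i j hij => ?_, by simp⟩
  by_cases hj : j < n
  · have hi := hij.trans hj
    simpa [hi, hj] using hk (by simpa using hij)
  · by_cases hi : i < n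
    · have := Finset.single_le_sum (f := k) (fun _ _ => Nat.zero_le _) (Finset.mem_univ ⟨i, hi⟩)
      simp only [hi, hj, dite_true, dite_false]
      omega
    · simpa [hi, hj] using hij

lemma isSpreading_of_norm_comp_eq {e : ℕ → E}
    (h : ∀ κ : ℕ → ℕ, StrictMono κ → ∀ a : ℕ →₀ ℝ, ‖Λ (e ∘ κ) a‖ = ‖Λ e a‖) : IsSpreading e := by
  intro n a k hk
  obtain ⟨κ, hκ, hκk⟩ := exists_strictMono_extend hk
  have := h κ hκ (∑ i : Fin n, Finsupp.single (i : ℕ) (a i))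
  simpa [map_sum, Finsupp.linearCombination_single, hκk] using this.symm

/-! ### Weak continuity and suppression of coordinates -/

/-- Mazur's theorem: the set `D` of vectors satisfying the generic bound is convex, so the weak
limit lies in its norm closure. The gap between `c` and `c'` pays for a norm approximation from `D`,
uniformly in `s`. -/
lemma norm_le_of_tendsto_toWeakSpace {𝒢 : Filter (ℕ → Finset ℕ)} (R : (ℕ → Finset ℕ) → X)
    (α : ℝ) {c c' : ℝ} (hc : c < c') {l : Filter ℕ} [l.NeBot] {z : ℕ → X} {z₀ : X}
    (hz : Tendsto (fun m => toWeakSpace ℝ X (z m)) l (𝓝 (toWeakSpace ℝ X z₀)))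
    (h : ∀ᶠ m in l, ∀ᶠ s in 𝒢, ‖R s + α • z m‖ ≤ c) : ∀ᶠ s in 𝒢, ‖R s + α • z₀‖ ≤ c' := by
  let D : Set X := {z | ∀ᶠ s in 𝒢, ‖R s + α • z‖ ≤ c}
  have hD : Convex ℝ D := by
    intro p hp q hq u v hu hv huv
    filter_upwards [hp, hq] with s h1 h2
    calc ‖R s + α • (u • p + v • q)‖ = ‖u • (R s + α • p) + v • (R s + α • q)‖ := by
          congr 1
          nth_rewrite 1 [show R s = (u + v) • R s by rw [huv, one_smul]]
          module
      _ ≤ ‖u • (R s + α • p)‖ + ‖v • (R s + α • q)‖ := norm_add_le _ _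
      _ = u * ‖R s + α • p‖ + v * ‖R s + α • q‖ := by
          rw [norm_smul, norm_smul, Real.norm_of_nonneg hu, Real.norm_of_nonneg hv]
      _ ≤ u * c + v * c := by gcongr
      _ = c := by rw [← add_mul, huv, one_mul]
  have hmem : toWeakSpace ℝ X z₀ ∈ closure (toWeakSpace ℝ X '' D) :=
    mem_closure_of_tendsto hz (h.mono fun m hm => ⟨z m, hm, rfl⟩)
  rw [← hD.toWeakSpace_closure ℝ] at hmem
  obtain ⟨z₁, hz₁, hz₁'⟩ := hmem
  obtain rfl := (toWeakSpace ℝ X).injective hz₁'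
  obtain ⟨p, hp, hdist⟩ := Metric.mem_closure_iff.1 hz₁ ((c' - c) / (|α| + 1))
    (div_pos (sub_pos.2 hc) (by positivity))
  filter_upwards [hp] with s hs
  rw [dist_eq_norm, lt_div_iff₀ (by positivity)] at hdist
  calc ‖R s + α • z₁‖ = ‖(R s + α • p) + α • (z₁ - p)‖ := by congr 1; module
    _ ≤ ‖R s + α • p‖ + |α| * ‖z₁ - p‖ := by
        refine (norm_add_le _ _).trans_eq ?_
        rw [norm_smul, Real.norm_eq_abs]
    _ ≤ c' := by nlinarith [norm_nonneg (z₁ - p)]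

/-- `ψ` extends `y` from `restrict F M` to `restrict (hat F) M`, in such a way that it is weakly
continuous with respect to one-point prolongations along `U`. -/
structure IsWeakExtension (F : Set (Finset ℕ)) (U : Ultrafilter ℕ) (M : Set ℕ)
    (y ψ : Finset ℕ → X) : Prop where
  eq : ∀ s ∈ restrict F M, ψ s = y s
  tendsto : ∀ t ∈ restrict (hat F) M, t ∉ F →
    Tendsto (fun m => toWeakSpace ℝ X (ψ (insert m t))) U (𝓝 (toWeakSpace ℝ X (ψ t)))

lemma IsNext.mono (h : IsNext F I t j) (hJ : J ⊆ I) (hj : j ∈ J) : IsNext F J t j :=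
  ⟨⟨hj, h.1.2⟩, fun i hi => h.2 i ⟨hJ hi.1, hi.2⟩⟩

/-- Replacing a coordinate by the value of the weakly continuous extension at its initial state
does not increase the norm. -/
lemma IsWeakExtension.eventually_norm_le {y ψ : Finset ℕ → X} (hψ : IsWeakExtension F U M y ψ)
    (hF : IsRegularThin F) (hU : (U : Filter ℕ) ≤ atTop) (hM : M ∈ U) (hi : i ∈ I)
    {R : (ℕ → Finset ℕ) → X}
    (hR : ∀ s s' : ℕ → Finset ℕ, (∀ j ∈ I.erase i, s j = s' j) → R s = R s') (α : ℝ) :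
    ∀ t, IsState F M 0 I t → ∀ c c' : ℝ, c < c' →
      (∀ᶠ s in (generic hF U I t : Filter _), ‖R s + α • y (s i)‖ ≤ c) →
      ∀ᶠ s in (generic hF U (I.erase i) t : Filter _), ‖R s + α • ψ (t i)‖ ≤ c' := by
  intro t
  induction t using generic_induction hF hU I with
  | done t ht =>
    intro hst c c' hc h
    rw [generic_of_not_active ht] at h
    rw [generic_of_not_active fun j hj => ht j ⟨Finset.mem_of_mem_erase hj.1, hj.2⟩]
    have htF : t i ∈ F := by_contra fun hn => ht i ⟨hi, hst.mem_hat i hi, hn⟩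
    rw [hψ.eq _ ⟨htF, hst.subset i hi⟩]
    exact (show ‖R t + α • y (t i)‖ ≤ c from h).trans hc.le
  | step t j hj ih =>
    intro hst c c' hc h
    rw [eventually_generic_of_isNext hU hj] at h
    have hst' := hst.eventually_addElt hF hU hM hj
    -- At a turn of `i` the new element enters only through `ψ (insert m (t i))`, whose weak limit
    -- is `ψ (t i)`; part of the gap between `c` and `c'` is spent. At any other turn both
    -- constructions make the same step.
    by_cases hij : j = i
    · subst hij
      obtain ⟨c'', hc1, hc2⟩ := exists_between hc
      refine norm_le_of_tendsto_toWeakSpace R α hc2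
        (hψ.tendsto (t j) ⟨hj.1.2.1, hst.subset j hi⟩ hj.1.2.2) ?_
      filter_upwards [ih, h, hst'] with m h1 h2 h3
      have := h1 h3 c c'' hc1 h2
      rw [addElt_self] at this
      refine eventually_generic_mono hU subset_rfl (fun s s' hss hs => ?_) _ _ (fun a ha => ?_) this
      · rwa [← hR s s' hss]
      · rw [addElt_of_ne (Finset.ne_of_mem_erase ha)]
    · have hj' : IsNext F (I.erase i) t j :=
        hj.mono (Finset.erase_subset _ _) (Finset.mem_erase.2 ⟨hij, hj.1.1⟩)
      rw [eventually_generic_of_isNext hU hj']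
      filter_upwards [ih, h, hst'] with m h1 h2 h3
      have := h1 h3 c c' hc h2
      rwa [addElt_of_ne (Ne.symm hij)] at this

/-- Coordinates of weakly null sequences can be suppressed. -/
lemma IsWeakExtension.eventually_norm_erase_le {y ψ : Finset ℕ → X}
    (hψ : IsWeakExtension F U M y ψ) (hψ0 : ψ ∅ = 0) (hne : F.Nonempty)
    (hU : (U : Filter ℕ) ≤ atTop) (hM : M ∈ U) (a : ℕ →₀ ℝ) (i : ℕ) {c c' : ℝ} (hc : c < c')
    (h : ∀ᶠ s in (genericSeq hF U : Filter _), ‖Λ (y ∘ s) a‖ ≤ c) :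
    ∀ᶠ s in (genericSeq hF U : Filter _), ‖Λ (y ∘ s) (a.erase i)‖ ≤ c' := by
  rw [eventually_genericSeq] at h ⊢
  obtain ⟨k, hk⟩ := exists_support_subset_range a
  filter_upwards [h, eventually_hyperfilter_ge (k + 1), eventually_hyperfilter_ge (i + 1)]
    with n h hkn hin
  have hsupp : (a.erase i).support ⊆ (Finset.range n).erase i := by
    rw [Finsupp.support_erase]
    exact Finset.erase_subset_erase _ (hk.trans (by simpa using hkn))
  have hR : ∀ s s' : ℕ → Finset ℕ, (∀ j ∈ (Finset.range n).erase i, s j = s' j) →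
      Λ (y ∘ s) (a.erase i) = Λ (y ∘ s') (a.erase i) := fun s s' hss =>
    linearCombination_congr_on fun j hj => by simp [hss j (hsupp hj)]
  -- From the empty tuple, coordinate `i` gets replaced by `ψ ∅ = 0`.
  have := hψ.eventually_norm_le hF hU hM (Finset.mem_range.2 hin) hR (a i) _
    (isState_empty hne 0) c c' hc (h.mono fun s hs => ?_)
  · simp only [hψ0, smul_zero, add_zero] at this
    refine eventually_generic_mono hU (Finset.erase_subset _ _) (fun s s' hss hs => ?_) _ _
      (fun _ _ => rfl) this
    rwa [← hR s s' hss]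
  · nth_rewrite 1 [← Finsupp.erase_add_single i a] at hs
    rwa [map_add, Finsupp.linearCombination_single] at hs

/-! ### Subordinated sequences -/

lemma tendsto_charFn_insert (t : Finset ℕ) :
    Tendsto (fun m => charFn (insert m t)) atTop (𝓝 (charFn t)) := by
  rw [tendsto_pi_nhds]
  intro j
  refine tendsto_const_nhds.congr' ?_
  filter_upwards [eventually_gt_atTop j] with m hm
  simp [charFn, hm.ne]

/-- Take the continuous extension minus `x₀`. Its value at `∅` vanishes because a generic member
escaping to infinity converges to `∅` in the Cantor space, while its `x`-value converges weakly to
`x₀`. One `ψ` serves all `U` and `M`, as models along different subsequences require. -/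
lemma exists_isWeakExtension (hF : IsRegularThin F) (hne : F.Nonempty) (hL : L.Infinite)
    {x : Finset ℕ → X} {x₀ : X}
    (hsub : IsSubordinated F L (fun s => toWeakSpace ℝ X (x s)))
    (hlim : FConverges F L (fun s => toWeakSpace ℝ X (x s)) (toWeakSpace ℝ X x₀)) :
    ∃ ψ : Finset ℕ → X, ψ ∅ = 0 ∧ ∀ (U : Ultrafilter ℕ) (M : Set ℕ), (U : Filter ℕ) ≤ atTop →
      M ⊆ L → M ∈ U → IsWeakExtension F U M (fun s => x s - x₀) ψ := by
  obtain ⟨φ, hφ, hφx⟩ := hsub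
  refine ⟨fun t => (toWeakSpace ℝ X).symm (φ (charFn t)) - x₀, ?_, ?_⟩
  · obtain ⟨U, hU, hLU⟩ := exists_ultrafilter_mem hL
    have hgood := fun N => eventually_generic_isGood (hF := hF) hne hU hLU N {0}
    have h1 : Tendsto (fun s : ℕ → Finset ℕ => charFn (s 0))
        (generic hF U {0} fun _ => ∅ : Filter _)
        (𝓝[charFn '' restrict (hat F) L] (charFn ∅)) := by
      refine tendsto_nhdsWithin_iff.2 ⟨?_, ?_⟩
      · rw [tendsto_pi_nhds]
        intro j
        refine tendsto_const_nhds.congr' ?_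
        filter_upwards [hgood (j + 1)] with s hs
        have : j ∉ s 0 := fun hj => by
          have := hs.le 0 (by simp) j hj
          omega
        simp [charFn, this]
      · filter_upwards [hgood 0] with s hs
        have := hs.mem 0 (by simp)
        exact ⟨_, ⟨subset_hat this.1, this.2⟩, rfl⟩
    have h2 := (hφ (charFn ∅) ⟨∅, ⟨empty_mem_hat hne, by simp⟩, rfl⟩).tendsto.comp h1
    have h3 : Tendsto (fun s : ℕ → Finset ℕ => φ (charFn (s 0)))
        (generic hF U {0} fun _ => ∅ : Filter _) (𝓝 (toWeakSpace ℝ X x₀)) := by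
      refine tendsto_nhds.2 fun V hV hxV => ?_
      obtain ⟨m, hm⟩ := hlim V hV hxV
      filter_upwards [hgood (elt L m)] with s hs
      have h0 := hs.mem 0 (by simp)
      rw [Set.mem_preimage, hφx _ h0]
      exact hm _ h0 (hs.le 0 (by simp))
    have := tendsto_nhds_unique h2 h3
    simp [this]
  · intro U M hU hML hM
    refine ⟨fun s hs => ?_, fun t ht htF => ?_⟩
    · have := hφx s ⟨hs.1, hs.2.trans hML⟩
      simp [this]
    · simp only [map_sub, LinearEquiv.apply_symm_apply]
      refine Tendsto.sub_const ?_ _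
      have h1 := (hφ (charFn t) ⟨t, ⟨ht.1, ht.2.trans hML⟩, rfl⟩).tendsto
      refine h1.comp (tendsto_nhdsWithin_iff.2 ⟨(tendsto_charFn_insert t).mono_left hU, ?_⟩)
      filter_upwards [hM, hU (hF.eventually_insert_mem_hat ht.1 htF)] with m h2 h3
      exact ⟨_, ⟨h3, by simpa [Set.insert_subset_iff] using ⟨hML h2, ht.2.trans hML⟩⟩, rfl⟩

end FSpreading

namespace FSpreading

variable {F : Set (Finset ℕ)} {hF : IsRegularThin F} {U : Ultrafilter ℕ} {L M : Set ℕ}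
  {X : Type*} [NormedAddCommGroup X] [NormedSpace ℝ X]
  {E : Type*} [SeminormedAddCommGroup E] [NormedSpace ℝ E]

local notation "Λ" => Finsupp.linearCombination ℝ

/-! ### The limit seminorm -/

/-- The sum of the coefficients. -/
noncomputable def coeffSum : (ℕ →₀ ℝ) →ₗ[ℝ] ℝ := Λ fun _ => (1 : ℝ)

local notation "σ" => coeffSum

lemma coeffSum_eq_sum_range {a : ℕ →₀ ℝ} {n : ℕ} (h : a.support ⊆ Finset.range n) :
    σ a = ∑ i ∈ Finset.range n, a i := by
  simp [coeffSum, linearCombination_eq_sum_range _ h]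

lemma coeffSum_mapDomain (κ : ℕ → ℕ) (a : ℕ →₀ ℝ) : σ (a.mapDomain κ) = σ a := by
  rw [coeffSum, Finsupp.linearCombination_mapDomain]
  rfl

lemma linearCombination_sub_const {V : Type*} [AddCommGroup V] [Module ℝ V] (v : ℕ → V) (z : V)
    (a : ℕ →₀ ℝ) : Λ (fun n => v n - z) a = Λ v a - σ a • z := by
  simp only [coeffSum, Finsupp.linearCombination_apply, Finsupp.sum, smul_sub,
    Finset.sum_sub_distrib, Finset.sum_smul, smul_eq_mul, mul_one]

lemma norm_linearCombination_le {V : Type*} [SeminormedAddCommGroup V] [NormedSpace ℝ V]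
    {v : ℕ → V} {C : ℝ} {a : ℕ →₀ ℝ} {n : ℕ} (h : a.support ⊆ Finset.range n)
    (hv : ∀ i < n, ‖v i‖ ≤ C) : ‖Λ v a‖ ≤ C * ∑ i ∈ Finset.range n, |a i| := by
  rw [linearCombination_eq_sum_range v h, Finset.mul_sum]
  refine (norm_sum_le _ _).trans (Finset.sum_le_sum fun i hi => ?_)
  rw [norm_smul, Real.norm_eq_abs, mul_comm]
  exact mul_le_mul_of_nonneg_right (hv i (Finset.mem_range.1 hi)) (abs_nonneg _)

/-- Bounded real functions converge along an ultrafilter, so no model of `y` need be known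
beforehand; the seminorm axioms pass to the limit. -/
lemma exists_limit_seminorm (hF : IsRegularThin F) (hne : F.Nonempty) (hU : (U : Filter ℕ) ≤ atTop)
    (hM : M ∈ U) {y : Finset ℕ → X} {C : ℝ} (hy : ∀ s ∈ restrict F M, ‖y s‖ ≤ C) :
    ∃ Q : Seminorm ℝ (ℕ →₀ ℝ), ∀ a,
      Tendsto (fun s => ‖Λ (y ∘ s) a‖) (genericSeq hF U) (𝓝 (Q a)) := by
  have hlim : ∀ a : ℕ →₀ ℝ, ∃ q, Tendsto (fun s => ‖Λ (y ∘ s) a‖) (genericSeq hF U) (𝓝 q) := by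
    intro a
    obtain ⟨n, hn⟩ := exists_support_subset_range a
    have : ∀ᶠ s in (genericSeq hF U : Filter _),
        ‖Λ (y ∘ s) a‖ ∈ Set.Icc 0 (C * ∑ i ∈ Finset.range (n + 1), |a i|) := by
      filter_upwards [eventually_genericSeq_isGood (hF := hF) hne hU hM 0 (n + 1)] with s hs
      exact ⟨norm_nonneg _, norm_linearCombination_le hn fun i hi =>
        hy _ (hs.mem i (Finset.mem_range.2 hi))⟩
    obtain ⟨q, -, hq⟩ := isCompact_Icc.ultrafilter_le_nhds
      ((genericSeq hF U).map fun s => ‖Λ (y ∘ s) a‖) (le_principal_iff.2 this)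
    exact ⟨q, hq⟩
  choose Q hQ using hlim
  refine ⟨Seminorm.of Q (fun a b => ?_) (fun r a => ?_), hQ⟩
  · refine le_of_tendsto_of_tendsto' (hQ (a + b)) ((hQ a).add (hQ b)) fun s => ?_
    rw [map_add]
    exact norm_add_le _ _
  · refine tendsto_nhds_unique (hQ (r • a)) (((hQ a).const_mul ‖r‖).congr fun s => ?_)
    rw [map_smul, norm_smul]

lemma IsWeakExtension.erase_le {y ψ : Finset ℕ → X} (hψ : IsWeakExtension F U M y ψ)
    (hψ0 : ψ ∅ = 0) (hne : F.Nonempty) (hU : (U : Filter ℕ) ≤ atTop) (hM : M ∈ U)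
    {q : Seminorm ℝ (ℕ →₀ ℝ)}
    (hq : ∀ a, Tendsto (fun s => ‖Λ (y ∘ s) a‖) (genericSeq hF U) (𝓝 (q a)))
    (a : ℕ →₀ ℝ) (i : ℕ) : q (a.erase i) ≤ q a := by
  refine le_of_forall_pos_le_add fun ε hε => ?_
  refine le_of_tendsto (hq (a.erase i))
    (hψ.eventually_norm_erase_le hψ0 hne hU hM a i (c := q a + ε / 2) (by linarith) ?_)
  exact ((tendsto_order.1 (hq a)).2 _ (by linarith)).mono fun _ h => h.le

/-! ### Seminorms decreasing under suppression of coordinates -/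

section Suppression

variable {q : Seminorm ℝ (ℕ →₀ ℝ)} {f : ℕ → E}

/-- Only finitely many coordinates of the support have to be erased. -/
lemma seminorm_filter_le (hq : ∀ a i, q (a.erase i) ≤ q a) (p : ℕ → Prop) [DecidablePred p]
    (a : ℕ →₀ ℝ) : q (a.filter p) ≤ q a := by
  have key : ∀ S : Finset ℕ, q (a.filter (· ∉ S)) ≤ q a := by
    intro S
    induction S using Finset.induction_on with
    | empty => exact le_of_eq (congrArg q (by ext j; simp))
    | insert i S _ ih =>
      refine le_trans (le_of_eq_of_le ?_ (hq _ i)) ih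
      congr 1
      ext j
      by_cases hj : j = i <;> simp [Finsupp.filter_apply, hj]
  convert key (a.support.filter (¬ p ·)) using 2
  ext j
  by_cases hj : p j <;> by_cases ha : a j = 0 <;> simp [hj, ha]

/-- The difference of `a` and its translate by `n`. -/
noncomputable def subShift (n : ℕ) (a : ℕ →₀ ℝ) : ℕ →₀ ℝ := a - a.mapDomain (· + n)

lemma coeffSum_subShift (n : ℕ) (a : ℕ →₀ ℝ) : σ (subShift n a) = 0 := by
  rw [subShift, map_sub, coeffSum_mapDomain, sub_self]

lemma mapDomain_add_apply_of_lt {n j : ℕ} (h : j < n) (a : ℕ →₀ ℝ) :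
    a.mapDomain (· + n) j = 0 :=
  Finsupp.mapDomain_of_notMem_range _ _ fun ⟨i, hi⟩ => by dsimp only at hi; omega

lemma filter_subShift {n : ℕ} {a : ℕ →₀ ℝ} (h : a.support ⊆ Finset.range n) :
    (subShift n a).filter (· < n) = a := by
  ext j
  by_cases hj : j < n
  · simp [hj, subShift, mapDomain_add_apply_of_lt hj]
  · have : a j = 0 := Finsupp.notMem_support_iff.1 fun h' => hj (Finset.mem_range.1 (h h'))
    simp [hj, this]

lemma strictMono_add_right (n : ℕ) : StrictMono fun i : ℕ => i + n := fun _ _ h => by simpa using h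

/-- Subtracting a translate beyond the support makes the coefficient sum zero, where `f` and `q`
agree. Suppression recovers `a` from the difference, and spreading gives both halves the same
`f`-norm. -/
lemma seminorm_le_two_mul_norm (hq : ∀ a i, q (a.erase i) ≤ q a) (hf0 : ∀ a, σ a = 0 → ‖Λ f a‖ = q a)
    (hfs : ∀ κ : ℕ → ℕ, StrictMono κ → ∀ a : ℕ →₀ ℝ, ‖Λ (f ∘ κ) a‖ = ‖Λ f a‖)
    (a : ℕ →₀ ℝ) : q a ≤ 2 * ‖Λ f a‖ := by
  obtain ⟨n, hn⟩ := exists_support_subset_range a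
  calc q a = q ((subShift (n + 1) a).filter (· < n + 1)) := by rw [filter_subShift hn]
    _ ≤ q (subShift (n + 1) a) := seminorm_filter_le hq _ _
    _ = ‖Λ f (subShift (n + 1) a)‖ := (hf0 _ (coeffSum_subShift _ _)).symm
    _ ≤ ‖Λ f a‖ + ‖Λ f (a.mapDomain (· + (n + 1)))‖ := by
        rw [subShift, map_sub]
        exact norm_sub_le _ _
    _ = 2 * ‖Λ f a‖ := by
        rw [Finsupp.linearCombination_mapDomain, hfs _ (strictMono_add_right _), two_mul]

/-- Positive and negative parts are suppressions of `a`, so each has `d` times its mass at most `q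
a`. One factor `2` comes from adding them, the other from `q a ≤ 2 * ‖Λ f a‖`. -/
lemma norm_lower_bound (hq : ∀ a i, q (a.erase i) ≤ q a) (hf0 : ∀ a, σ a = 0 → ‖Λ f a‖ = q a)
    (hfs : ∀ κ : ℕ → ℕ, StrictMono κ → ∀ a : ℕ →₀ ℝ, ‖Λ (f ∘ κ) a‖ = ‖Λ f a‖)
    {d : ℝ} (hd : ∀ a : ℕ →₀ ℝ, (∀ i, 0 ≤ a i) → d * σ a ≤ q a)
    {a : ℕ →₀ ℝ} {n : ℕ} (hn : a.support ⊆ Finset.range n) :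
    d / 4 * ∑ i ∈ Finset.range n, |a i| ≤ ‖Λ f a‖ := by
  have h1 := seminorm_le_two_mul_norm hq hf0 hfs a
  have hp : d * σ (a.filter (0 ≤ a ·)) ≤ q a :=
    (hd _ fun i => by
      by_cases h : 0 ≤ a i <;> simp [h]).trans (seminorm_filter_le hq _ _)
  have hm : d * σ (-a.filter (¬ 0 ≤ a ·)) ≤ q a := by
    refine (hd _ fun i => ?_).trans ?_
    · rw [Finsupp.neg_apply, Finsupp.filter_apply]
      split_ifs with h
      · simp
      · simpa using (not_le.1 h).le
    · rw [map_neg_eq_map]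
      exact seminorm_filter_le hq _ _
  have hsupp : ∀ (p : ℕ → Prop) [DecidablePred p], (a.filter p).support ⊆ Finset.range n :=
    fun p _ => (Finset.filter_subset _ _).trans hn
  have hsum : ∑ i ∈ Finset.range n, |a i| =
      σ (a.filter (0 ≤ a ·)) + σ (-a.filter (¬ 0 ≤ a ·)) := by
    rw [map_neg, coeffSum_eq_sum_range (hsupp _), coeffSum_eq_sum_range (hsupp _), ← sub_eq_add_neg,
      ← Finset.sum_sub_distrib]
    refine Finset.sum_congr rfl fun i _ => ?_
    by_cases h : 0 ≤ a i
    · simp [h, abs_of_nonneg h]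
    · simp [Finsupp.filter_apply, h, abs_of_neg (not_le.1 h)]
  rw [hsum]
  linarith

end Suppression

/-! ### Sums over initial segments -/

/-- The first `n` coefficients of `a`. -/
noncomputable def cut (n : ℕ) (a : ℕ → ℝ) : ℕ →₀ ℝ := ∑ i ∈ Finset.range n, Finsupp.single i (a i)

lemma cut_apply (n : ℕ) (a : ℕ → ℝ) (i : ℕ) : cut n a i = if i < n then a i else 0 := by
  simp [cut, Finsupp.finsetSum_apply, Finsupp.single_apply]

lemma support_cut (n : ℕ) (a : ℕ → ℝ) : (cut n a).support ⊆ Finset.range n := fun i hi => by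
  by_contra h
  simp only [Finset.mem_range] at h
  simp [cut_apply, h] at hi

lemma linearCombination_cut {V : Type*} [AddCommGroup V] [Module ℝ V] (v : ℕ → V) (n : ℕ)
    (a : ℕ → ℝ) : Λ v (cut n a) = ∑ i ∈ Finset.range n, a i • v i := by
  simp [cut, map_sum]

lemma sum_abs_cut (n : ℕ) (a : ℕ → ℝ) :
    ∑ i ∈ Finset.range n, |cut n a i| = ∑ i ∈ Finset.range n, |a i| :=
  Finset.sum_congr rfl fun i hi => by rw [cut_apply, if_pos (Finset.mem_range.1 hi)]

/-! ### Equivalence with the usual basis of `ℓ¹` -/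

lemma norm_sum_l1Basis (n : ℕ) (a : ℕ → ℝ) :
    ‖∑ i ∈ Finset.range n, a i • l1Basis i‖ = ∑ i ∈ Finset.range n, |a i| := by
  have := lp.norm_sum_single (E := fun _ : ℕ => ℝ) (p := 1) (by simp) a (Finset.range n)
  simp only [ENNReal.toReal_one, Real.rpow_one, Real.norm_eq_abs] at this
  rw [← this]
  congr 1
  refine Finset.sum_congr rfl fun i _ => ?_
  rw [l1Basis, ← lp.single_smul, smul_eq_mul, mul_one]

lemma norm_eq_norm_zero {f : ℕ → E}
    (hfs : ∀ κ : ℕ → ℕ, StrictMono κ → ∀ a : ℕ →₀ ℝ, ‖Λ (f ∘ κ) a‖ = ‖Λ f a‖) (n : ℕ) :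
    ‖f n‖ = ‖f 0‖ := by
  have := hfs _ (strictMono_add_right n) (Finsupp.single 0 1)
  simpa using this

lemma equivSeq_l1Basis {f : ℕ → E}
    (hfs : ∀ κ : ℕ → ℕ, StrictMono κ → ∀ a : ℕ →₀ ℝ, ‖Λ (f ∘ κ) a‖ = ‖Λ f a‖) {c : ℝ} (hc : 0 < c)
    (h : ∀ (a : ℕ →₀ ℝ) (n : ℕ), a.support ⊆ Finset.range n →
      c * ∑ i ∈ Finset.range n, |a i| ≤ ‖Λ f a‖) : EquivSeq f l1Basis := by
  -- The `+ 1` makes the upper constant positive without knowing `‖f 0‖ ≠ 0`.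
  refine ⟨c, ‖f 0‖ + 1, hc, by positivity, fun n a => ?_⟩
  rw [norm_sum_l1Basis, ← linearCombination_cut, ← sum_abs_cut]
  refine ⟨h _ _ (support_cut n a), norm_linearCombination_le (support_cut n a) fun i _ => ?_⟩
  rw [norm_eq_norm_zero hfs]
  linarith

lemma EquivSeq.isSchauderBasic {f : ℕ → E} (h : EquivSeq f l1Basis) : IsSchauderBasic f := by
  obtain ⟨c, C, hc, hC, h⟩ := h
  refine ⟨max 1 (C / c), le_max_left _ _, fun a k m hkm => ?_⟩
  have h1 := (h k a).2
  have h2 := (h m a).1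
  rw [norm_sum_l1Basis] at h1 h2
  calc _ ≤ C * ∑ i ∈ Finset.range k, |a i| := h1
    _ ≤ C * ∑ i ∈ Finset.range m, |a i| := by
        refine mul_le_mul_of_nonneg_left ?_ hC.le
        exact Finset.sum_le_sum_of_subset_of_nonneg (by simpa using hkm) fun _ _ _ => abs_nonneg _
    _ = C / c * (c * ∑ i ∈ Finset.range m, |a i|) := by field_simp
    _ ≤ C / c * ‖∑ n ∈ Finset.range m, a n • f n‖ := by gcongr
    _ ≤ _ := by gcongr; exact le_max_right _ _

end FSpreading

namespace FSpreading

variable {F : Set (Finset ℕ)} {hF : IsRegularThin F} {U : Ultrafilter ℕ} {L M : Set ℕ}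
  {X : Type*} [NormedAddCommGroup X] [NormedSpace ℝ X]
  {E : Type*} [SeminormedAddCommGroup E] [NormedSpace ℝ E]

local notation "Λ" => Finsupp.linearCombination ℝ
local notation "σ" => coeffSum

/-! ### Realizing the limit seminorm along a subsequence -/

lemma abs_norm_sum_sub_le {V : Type*} [SeminormedAddCommGroup V] [NormedSpace ℝ V] {n : ℕ}
    {v : Fin n → V} {a b : Fin n → ℝ} {B η : ℝ} (hv : ∀ i, ‖v i‖ ≤ B) (hab : dist a b ≤ η) :
    |‖∑ i, a i • v i‖ - ‖∑ i, b i • v i‖| ≤ n * (η * B) := by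
  refine (abs_norm_sub_norm_le _ _).trans ?_
  rw [← Finset.sum_sub_distrib]
  refine (norm_sum_le _ _).trans ?_
  calc ∑ i, ‖a i • v i - b i • v i‖ ≤ ∑ _i : Fin n, η * B := by
        refine Finset.sum_le_sum fun i _ => ?_
        rw [← sub_smul, norm_smul]
        have h1 : ‖a i - b i‖ ≤ η := by
          rw [← dist_eq_norm]
          exact (dist_le_pi_dist a b i).trans hab
        exact mul_le_mul h1 (hv i) (norm_nonneg _) ((norm_nonneg _).trans h1)
    _ = n * (η * B) := by simp

lemma sum_fin_eq_linearCombination {V : Type*} [AddCommGroup V] [Module ℝ V] (v : ℕ → V) {n : ℕ}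
    (a : Fin n → ℝ) :
    ∑ i : Fin n, a i • v i = Λ v (∑ i : Fin n, Finsupp.single (i : ℕ) (a i)) := by
  simp [map_sum]

/-- Convergence on a finite `η`-net of the cube suffices: both norms are Lipschitz in the
coefficients, and `η` is chosen so that each of the three errors is at most `ε / 3`. -/
lemma eventually_forall_abs_norm_sub_le (hne : F.Nonempty) (hU : (U : Filter ℕ) ≤ atTop)
    (hL : L ∈ U) {y : Finset ℕ → X} {C : ℝ} (hC : ∀ s ∈ restrict F L, ‖y s‖ ≤ C) {e : ℕ → E}
    (h : ∀ a, Tendsto (fun s => ‖Λ (y ∘ s) a‖) (genericSeq hF U) (𝓝 ‖Λ e a‖)) (k : ℕ) {ε : ℝ}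
    (hε : 0 < ε) :
    ∀ᶠ s in (genericSeq hF U : Filter (ℕ → Finset ℕ)), ∀ a : Fin (k + 1) → ℝ,
      (∀ i, a i ∈ Set.Icc (-1 : ℝ) 1) →
        |‖∑ i, a i • y (s i)‖ - ‖∑ i, a i • e (i : ℕ)‖| ≤ ε := by
  set B : ℝ := 1 + |C| + ∑ i : Fin (k + 1), ‖e i‖ with hB
  have hsum : 0 ≤ ∑ i : Fin (k + 1), ‖e i‖ := Finset.sum_nonneg fun _ _ => norm_nonneg _
  have hB0 : 0 < B := by positivity
  have heB : ∀ i : Fin (k + 1), ‖e i‖ ≤ B := fun i => by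
    have := Finset.single_le_sum (f := fun i : Fin (k + 1) => ‖e i‖) (fun _ _ => norm_nonneg _)
      (Finset.mem_univ i)
    have := abs_nonneg C
    linarith
  set η : ℝ := ε / (3 * ((k + 1 : ℕ) * B)) with hη
  have hη0 : 0 < η := by positivity
  have hηB : ((k + 1 : ℕ) : ℝ) * (η * B) = ε / 3 := by
    rw [hη]
    field_simp
  have hK : IsCompact (Set.Icc (-1 : Fin (k + 1) → ℝ) 1) := isCompact_Icc
  obtain ⟨T, -, hT, hcov⟩ := hK.finite_cover_balls hη0
  have hev : ∀ᶠ s in (genericSeq hF U : Filter (ℕ → Finset ℕ)), ∀ b ∈ T,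
      |‖∑ i, b i • y (s i)‖ - ‖∑ i, b i • e (i : ℕ)‖| < ε / 3 := by
    refine (eventually_all_finite hT).2 fun b _ => ?_
    have := (Metric.tendsto_nhds.1 (h (∑ i : Fin (k + 1), Finsupp.single (i : ℕ) (b i)))) (ε / 3)
      (by positivity)
    filter_upwards [this] with s hs
    rw [Real.dist_eq, ← sum_fin_eq_linearCombination, ← sum_fin_eq_linearCombination] at hs
    exact hs
  filter_upwards [hev, eventually_genericSeq_isGood (hF := hF) hne hU hL 0 (k + 1)]
    with s hs hgood a ha
  have hyB : ∀ i : Fin (k + 1), ‖y (s i)‖ ≤ B := fun i => by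
    have := hC _ (hgood.mem i (Finset.mem_range.2 i.2))
    have := le_abs_self C
    linarith
  obtain ⟨b, hbT, hab⟩ := Set.mem_iUnion₂.1 (hcov ⟨fun i => (ha i).1, fun i => (ha i).2⟩)
  have h1 := abs_norm_sum_sub_le hyB (Metric.mem_ball.1 hab).le
  have h2 := abs_norm_sum_sub_le heB (Metric.mem_ball.1 hab).le
  rw [hηB] at h1 h2
  have h3 := hs b hbT
  rw [abs_le] at h1 h2 ⊢
  rw [abs_lt] at h3
  constructor <;> linarith [h1.1, h1.2, h2.1, h2.2, h3.1, h3.2]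

lemma exists_approximates (hne : F.Nonempty) (hU : (U : Filter ℕ) ≤ atTop)
    (hL : L ∈ U) {y : Finset ℕ → X} {C : ℝ} (hC : ∀ s ∈ restrict F L, ‖y s‖ ≤ C) {e : ℕ → E}
    (h : ∀ a, Tendsto (fun s => ‖Λ (y ∘ s) a‖) (genericSeq hF U) (𝓝 ‖Λ e a‖)) :
    ∃ M ⊆ L, M.Infinite ∧ Approximates F M y e := by
  obtain ⟨M, hML, hM, hS⟩ := exists_subset_forall_plegma (hF := hF) hU hL
    (fun l k => {s | ∀ a : Fin (k + 1) → ℝ, (∀ i, a i ∈ Set.Icc (-1 : ℝ) 1) →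
        |‖∑ i, a i • y (s i)‖ - ‖∑ i, a i • e (i : ℕ)‖| ≤ 1 / ((l : ℝ) + 1)})
    (fun l k _ => by
      refine eventually_generic_of_genericSeq hU (fun s s' hss hs a ha => ?_)
        (eventually_forall_abs_norm_sub_le hne hU hL hC h k (by positivity))
      have : ∀ i : Fin (k + 1), s i = s' i := fun i => hss i (Finset.mem_range.2 i.2)
      simpa only [this] using hs a ha)
  refine ⟨M, hML, hM, fun l => 1 / ((l : ℝ) + 1), fun l => by positivity,
    tendsto_one_div_add_atTop_nhds_zero_nat, fun l k hkl a ha s hs hpl hmin => ?_⟩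
  -- Finite tuples are padded with `∅` to sequences, as the diagonalization expects.
  have hs' : ∀ i : Fin (k + 1), (if hi : (i : ℕ) < k + 1 then s ⟨i, hi⟩ else ∅) = s i :=
    fun i => dif_pos i.2
  have := hS l k hkl (fun i => if hi : i < k + 1 then s ⟨i, hi⟩ else ∅) (fun i hi => ?_)
    (fun i hi => ?_) ?_ ?_ a ha
  · simpa only [hs'] using this
  · simpa [Nat.lt_succ_iff.2 hi] using hs _
  · simp [Nat.not_lt.2 (Nat.succ_le_iff.2 hi)]
  · simpa only [hs'] using hpl
  · simpa using hmin

/-- Every single member is a plegma family starting at or beyond `elt M 0`, so the estimate for `l =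
k = 0` covers it. -/
lemma Approximates.bounded {x : Finset ℕ → X} {e : ℕ → E} (h : Approximates F M x e)
    (hF : IsRegularThin F) (hF₁ : ∃ s ∈ F, s.Nonempty) :
    ∃ C, ∀ s ∈ restrict F M, ‖x s‖ ≤ C := by
  obtain ⟨δ, -, -, hx⟩ := h
  refine ⟨δ 0 + ‖e 0‖, fun s hs => ?_⟩
  have hne := hF.thin.nonempty_of_mem hF₁ hs.1
  have := hx 0 0 le_rfl (fun _ => 1) (by simp) (fun _ => s) (fun _ => hs)
    ⟨fun _ => hne, fun i j hij => absurd hij (by omega), fun _ _ k _ hk => elt_lt_elt (by omega) hk⟩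
    (fun n hn => by
      rw [elt, Nat.nth_zero]
      exact Nat.sInf_le (hs.2 hn))
  simp only [Nat.reduceAdd, one_smul, Finset.univ_unique, Fin.default_eq_zero,
    Finset.sum_const, Finset.card_singleton, Fin.val_zero, Finset.sum_singleton] at this
  have := (abs_le.1 this).2
  linarith

/-! ### Convex combinations -/

lemma Seminorm.tendsto_sub_smul (p : Seminorm ℝ (ℕ →₀ ℝ)) {b : ℕ → ℕ →₀ ℝ}
    (hb : Tendsto (fun m => p (b m)) atTop (𝓝 0)) (a : ℕ →₀ ℝ) (c : ℝ) :
    Tendsto (fun m => p (a - c • b m)) atTop (𝓝 (p a)) := by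
  rw [tendsto_iff_dist_tendsto_zero]
  refine squeeze_zero (fun _ => dist_nonneg) (fun m => ?_)
    (by simpa using hb.const_mul |c|)
  rw [Real.dist_eq, ← Real.norm_eq_abs c, ← map_smul_eq_mul p, abs_le]
  have h1 := map_sub_le_add p a (c • b m)
  have h2 := map_add_le_add p (a - c • b m) (c • b m)
  rw [sub_add_cancel] at h2
  constructor <;> linarith

/-- Seminorms which agree on vectors with vanishing coefficient sum, and which are both small at
the same convex combinations, coincide. -/
lemma norm_eq_of_tendsto_zero {q : Seminorm ℝ (ℕ →₀ ℝ)} {f : ℕ → E}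
    (hf0 : ∀ a, σ a = 0 → ‖Λ f a‖ = q a) {b : ℕ → ℕ →₀ ℝ} (hb : ∀ m, σ (b m) = 1)
    (hbq : Tendsto (fun m => q (b m)) atTop (𝓝 0))
    (hbf : Tendsto (fun m => ‖Λ f (b m)‖) atTop (𝓝 0)) (a : ℕ →₀ ℝ) : ‖Λ f a‖ = q a := by
  -- The vectors `a - σ a • b m` have coefficient sum zero and approximate `a` in both seminorms.
  have h1 := Seminorm.tendsto_sub_smul ((normSeminorm ℝ E).comp (Λ f)) hbf a (σ a)
  refine tendsto_nhds_unique (h1.congr fun m => ?_) (Seminorm.tendsto_sub_smul q hbq a (σ a))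
  exact hf0 _ (by simp [hb])

/-- Normalize vectors violating the bound for `d = 1 / (m + 1)`. -/
lemma exists_convex_tendsto_zero {q : Seminorm ℝ (ℕ →₀ ℝ)}
    (h : ¬ ∃ d > 0, ∀ a : ℕ →₀ ℝ, (∀ i, 0 ≤ a i) → d * σ a ≤ q a) :
    ∃ b : ℕ → ℕ →₀ ℝ, (∀ m i, 0 ≤ b m i) ∧ (∀ m, σ (b m) = 1) ∧
      Tendsto (fun m => q (b m)) atTop (𝓝 0) := by
  have : ∀ m : ℕ, ∃ b : ℕ →₀ ℝ, (∀ i, 0 ≤ b i) ∧ σ b = 1 ∧ q b ≤ 1 / ((m : ℝ) + 1) := by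
    intro m
    push Not at h
    obtain ⟨a, ha, hlt⟩ := h (1 / ((m : ℝ) + 1)) (by positivity)
    have hpos : 0 < σ a := by
      by_contra! hc
      have := mul_nonpos_of_nonneg_of_nonpos (show (0 : ℝ) ≤ 1 / ((m : ℝ) + 1) by positivity) hc
      have := apply_nonneg q a
      linarith
    refine ⟨(σ a)⁻¹ • a, fun i => ?_, ?_, ?_⟩
    · exact mul_nonneg (by positivity) (ha i)
    · rw [map_smul, smul_eq_mul, inv_mul_cancel₀ hpos.ne']
    · rw [map_smul_eq_mul, Real.norm_of_nonneg (by positivity), inv_mul_le_iff₀ hpos, mul_comm]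
      exact hlt.le
  choose b h1 h2 h3 using this
  exact ⟨b, h1, h2, squeeze_zero (fun _ => apply_nonneg _ _) h3
    tendsto_one_div_add_atTop_nhds_zero_nat⟩

/-- If `g` were at least `ε` along a subsequence, it would be so on its convex combinations with
weights `b m`; by spreading these have the norms `‖Λ f (b m)‖`, which tend to `0`. -/
lemma weak_limit_zero {Y : Type*} [NormedAddCommGroup Y] [NormedSpace ℝ Y] {f : ℕ → Y}
    (hfs : ∀ κ : ℕ → ℕ, StrictMono κ → ∀ a : ℕ →₀ ℝ, ‖Λ (f ∘ κ) a‖ = ‖Λ f a‖)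
    {b : ℕ → ℕ →₀ ℝ} (hb0 : ∀ m i, 0 ≤ b m i) (hb : ∀ m, σ (b m) = 1)
    (hbf : Tendsto (fun m => ‖Λ f (b m)‖) atTop (𝓝 0)) (g : StrongDual ℝ Y) :
    Tendsto (fun n => g (f n)) atTop (𝓝 0) := by
  have key : ∀ (g : StrongDual ℝ Y) (ε : ℝ), 0 < ε → ∀ᶠ n in atTop, g (f n) < ε := by
    intro g ε hε
    by_contra hc
    simp only [not_eventually, not_lt] at hc
    obtain ⟨κ, hκ, hle⟩ := extraction_of_frequently_atTop hc
    have h1 : ∀ m, ε ≤ ‖g‖ * ‖Λ f (b m)‖ := fun m => by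
      obtain ⟨n, hn⟩ := exists_support_subset_range (b m)
      rw [← hfs κ hκ]
      refine le_trans ?_ ((le_abs_self _).trans (g.le_opNorm _))
      calc ε = ε * σ (b m) := by rw [hb, mul_one]
        _ ≤ g (Λ (f ∘ κ) (b m)) := by
          rw [coeffSum_eq_sum_range hn, linearCombination_eq_sum_range _ hn, map_sum,
            Finset.mul_sum]
          refine Finset.sum_le_sum fun i _ => ?_
          rw [map_smul, smul_eq_mul, mul_comm]
          exact mul_le_mul_of_nonneg_left (hle i) (hb0 m i)
    have := ge_of_tendsto' (hbf.const_mul ‖g‖) h1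
    rw [mul_zero] at this
    linarith
  refine tendsto_order.2 ⟨fun c hc => ?_, fun c hc => key g c hc⟩
  filter_upwards [key (-g) (-c) (by linarith)] with n hn
  rw [neg_apply] at hn
  linarith

lemma tendsto_toWeakSpace_iff {Y : Type*} [NormedAddCommGroup Y] [NormedSpace ℝ Y] {f : ℕ → Y}
    {z : Y} (h : ∀ g : StrongDual ℝ Y, Tendsto (fun n => g (f n)) atTop (𝓝 (g z))) :
    Tendsto (fun n => toWeakSpace ℝ Y (f n)) atTop (𝓝 (toWeakSpace ℝ Y z)) := by
  have : Topology.IsInducing fun (x : WeakBilin (topDualPairing ℝ Y).flip) g =>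
      (topDualPairing ℝ Y).flip x g := ⟨rfl⟩
  exact this.tendsto_nhds_iff.2 (tendsto_pi_nhds.2 h)

end FSpreading

namespace FSpreading

variable {F : Set (Finset ℕ)} {hF : IsRegularThin F} {U : Ultrafilter ℕ} {L M : Set ℕ}
  {X : Type*} [NormedAddCommGroup X] [NormedSpace ℝ X]
  {E : Type*} [SeminormedAddCommGroup E] [NormedSpace ℝ E]

local notation "Λ" => Finsupp.linearCombination ℝ
local notation "σ" => coeffSum

/-! ### Comparison of the models of `x` and `x - x₀` -/

/-- Models of `x` and of `x - x₀` agree on vectors with vanishing coefficient sum. -/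
lemma tendsto_of_coeffSum_eq_zero {x : Finset ℕ → X} {x₀ : X} {e : ℕ → E}
    (h : Approximates F L x e) (hF₁ : ∃ s ∈ F, s.Nonempty) (hU : (U : Filter ℕ) ≤ atTop)
    (hL : L ∈ U) {a : ℕ →₀ ℝ} (ha : σ a = 0) :
    Tendsto (fun s => ‖Λ ((fun t => x t - x₀) ∘ s) a‖) (genericSeq hF U) (𝓝 ‖Λ e a‖) := by
  refine (h.tendsto_genericSeq hF₁ hU hL a).congr fun s => ?_
  have := linearCombination_sub_const (x ∘ s) x₀ a
  rw [ha, zero_smul, sub_zero] at this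
  rw [← this]
  rfl

/-- The reverse triangle inequality in the limit. At convex combinations with small `q` it
identifies the norm of `e₀`. -/
lemma Approximates.abs_norm_sub_le {x : Finset ℕ → X} {x₀ : X} {e : ℕ → E}
    (h : Approximates F L x e) (hF₁ : ∃ s ∈ F, s.Nonempty) (hU : (U : Filter ℕ) ≤ atTop)
    (hL : L ∈ U) {q : Seminorm ℝ (ℕ →₀ ℝ)}
    (hq : ∀ a, Tendsto (fun s => ‖Λ ((fun t => x t - x₀) ∘ s) a‖) (genericSeq hF U) (𝓝 (q a)))
    (a : ℕ →₀ ℝ) : |‖Λ e a‖ - ‖σ a • x₀‖| ≤ q a := by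
  refine le_of_tendsto_of_tendsto'
    (((h.tendsto_genericSeq (hF := hF) hF₁ hU hL a).sub_const ‖σ a • x₀‖).abs) (hq a) fun s => ?_
  have := linearCombination_sub_const (x ∘ s) x₀ a
  change |‖Λ (x ∘ s) a‖ - ‖σ a • x₀‖| ≤ ‖Λ (fun n => (x ∘ s) n - x₀) a‖
  rw [this]
  exact abs_norm_sub_norm_le _ _

lemma IsWeakExtension.norm_erase_le {y ψ : Finset ℕ → X} (hψ : IsWeakExtension F U M y ψ)
    (hψ0 : ψ ∅ = 0) (hF : IsRegularThin F) (hF₁ : ∃ s ∈ F, s.Nonempty)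
    (hU : (U : Filter ℕ) ≤ atTop) (hM : M ∈ U) {f : ℕ → E} (hf : Approximates F M y f)
    (a : ℕ →₀ ℝ) (i : ℕ) : ‖Λ f (a.erase i)‖ ≤ ‖Λ f a‖ :=
  hψ.erase_le (hF := hF) hψ0 (hF₁.imp fun _ h => h.1) hU hM
    (q := (normSeminorm ℝ E).comp (Λ f)) (hf.tendsto_genericSeq hF₁ hU hM) a i

lemma linearCombination_coe (e : ℕ → E) (a : ℕ →₀ ℝ) :
    Λ (fun n => (e n : UniformSpace.Completion E)) a = ((Λ e a : E) : UniformSpace.Completion E) :=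
  (Finsupp.apply_linearCombination ℝ 
    (UniformSpace.Completion.toComplL (𝕜 := ℝ) (E := E)).toLinearMap e a).symm

/-- Differences of the `b m` have coefficient sum zero, so their `e`-norms are controlled by `q`. -/
lemma exists_tendsto_completion {q : Seminorm ℝ (ℕ →₀ ℝ)} {e : ℕ → E}
    (he0 : ∀ a, σ a = 0 → ‖Λ e a‖ = q a) {b : ℕ → ℕ →₀ ℝ} (hb : ∀ m, σ (b m) = 1)
    (hbq : Tendsto (fun m => q (b m)) atTop (𝓝 0)) :
    ∃ e₀ : UniformSpace.Completion E,
      Tendsto (fun m => ((Λ e (b m) : E) : UniformSpace.Completion E)) atTop (𝓝 e₀) := by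
  refine cauchySeq_tendsto_of_complete (Metric.cauchySeq_iff.2 fun ε hε => ?_)
  obtain ⟨N, hN⟩ := eventually_atTop.1 ((tendsto_order.1 hbq).2 (ε / 2) (by positivity))
  refine ⟨N, fun m hm n hn => ?_⟩
  rw [dist_eq_norm, ← UniformSpace.Completion.coe_sub, UniformSpace.Completion.norm_coe, ← map_sub,
    he0 _ (by simp [hb])]
  have := map_sub_le_add q (b m) (b n)
  have := hN m hm
  have := hN n hn
  linarith

lemma linearIndependent_of_norm_erase_le {Y : Type*} [NormedAddCommGroup Y] [NormedSpace ℝ Y]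
    {f : ℕ → Y} (hf : ∀ (a : ℕ →₀ ℝ) i, ‖Λ f (a.erase i)‖ ≤ ‖Λ f a‖) (h0 : ∀ n, f n ≠ 0) :
    LinearIndependent ℝ f := by
  rw [linearIndependent_iff]
  intro a ha
  ext i
  have h1 := seminorm_filter_le (q := (normSeminorm ℝ Y).comp (Λ f)) hf (· = i) a
  have h2 : a.filter (· = i) = Finsupp.single i (a i) := by
    ext j
    by_cases hj : j = i
    · subst hj; simp
    · simp [hj]
  rw [h2] at h1
  change ‖Λ f (Finsupp.single i (a i))‖ ≤ ‖Λ f a‖ at h1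
  rw [ha, Finsupp.linearCombination_single, norm_zero] at h1
  simpa [h0 i] using norm_le_zero_iff.1 h1

/-- The combination with coefficients `a` is an initial partial sum of the one with coefficients
`subShift n a`. -/
lemma IsSchauderBasic.norm_le {e : ℕ → E} (h : IsSchauderBasic e) :
    ∃ C : ℝ, ∀ (a : ℕ →₀ ℝ) (n : ℕ), a.support ⊆ Finset.range n →
      ‖Λ e a‖ ≤ C * ‖Λ e (subShift n a)‖ := by
  obtain ⟨C, -, h⟩ := h
  refine ⟨C, fun a n hn => ?_⟩
  obtain ⟨k, hk⟩ := exists_support_subset_range (subShift n a)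
  have h1 := h (subShift n a) n (n + (k + 1)) (by omega)
  rw [← linearCombination_eq_sum_range e (n := n + (k + 1))
    (hk.trans (Finset.range_subset_range.2 (by omega)))] at h1
  refine le_of_eq_of_le ?_ h1
  rw [linearCombination_eq_sum_range e hn]
  refine congrArg _ (Finset.sum_congr rfl fun i hi => ?_)
  rw [subShift, Finsupp.sub_apply, mapDomain_add_apply_of_lt (Finset.mem_range.1 hi), sub_zero]

lemma seminorm_subShift_le {q : Seminorm ℝ (ℕ →₀ ℝ)}
    (hq : ∀ κ : ℕ → ℕ, StrictMono κ → ∀ a : ℕ →₀ ℝ, q (a.mapDomain κ) = q a) (n : ℕ) (a : ℕ →₀ ℝ) :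
    q (subShift n a) ≤ 2 * q a := by
  refine (map_sub_le_add q _ _).trans_eq ?_
  rw [hq _ (strictMono_add_right n), two_mul]

end FSpreading

/-! ### The dichotomy -/

theorem theorem6p14
    {X : Type u} [NormedAddCommGroup X] [NormedSpace ℝ X] [CompleteSpace X]
    {E : Type v} [SeminormedAddCommGroup E] [NormedSpace ℝ E]
    (F : Set (Finset ℕ)) (hF : IsRegularThin F) (hF₁ : ∃ s ∈ F, s.Nonempty)
    (L : Set ℕ) (hL : L.Infinite)
    (x : Finset ℕ → X) (e : ℕ → E)
    (hgen : Generates F L x e) (hnt : ¬ IsTrivial e)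
    (hsub : IsSubordinated F L (fun s => toWeakSpace ℝ X (x s)))
    (x₀ : X) (hlim : FConverges F L (fun s => toWeakSpace ℝ X (x s)) (toWeakSpace ℝ X x₀))
    (hx₀ : x₀ ≠ 0) :
    Xor
      (EquivSeq e l1Basis ∧
        ∀ (E' : Type w) [SeminormedAddCommGroup E'] [NormedSpace ℝ E'] (e' : ℕ → E'),
          IsSpreadingModelOf F L (fun s => x s - x₀) e' → EquivSeq e' l1Basis)
      (IsSingular e ∧
        ∃ e₀ : UniformSpace.Completion E, IsNaturalDecomposition e e₀ ∧ ‖e₀‖ = ‖x₀‖ ∧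
          IsSpreadingModelOf F L (fun s => x s - x₀)
            (fun n => (e n : UniformSpace.Completion E) - e₀) ∧
          ∀ (E' : Type w) [SeminormedAddCommGroup E'] [NormedSpace ℝ E'] (e' : ℕ → E'),
            IsSpreadingModelOf F L (fun s => x s - x₀) e' →
              IsometricSeq (fun n => (e n : UniformSpace.Completion E) - e₀) e') := by
  have hA : Approximates F L x e := hgen.2
  have hne : F.Nonempty := hF₁.imp fun _ h => h.1
  obtain ⟨U, hU, hLU⟩ := exists_ultrafilter_mem hL
  obtain ⟨ψ, hψ0, hψ⟩ := exists_isWeakExtension hF hne hL hsub hlim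
  obtain ⟨C, hC⟩ := hA.bounded hF hF₁
  have hCy : ∀ s ∈ restrict F L, ‖x s - x₀‖ ≤ C + ‖x₀‖ := fun s hs =>
    (norm_sub_le _ _).trans (by have := hC s hs; linarith)
  obtain ⟨q, hq⟩ := exists_limit_seminorm hF hne hU hLU hCy
  have hqe := (hψ U L hU subset_rfl hLU).erase_le hψ0 hne hU hLU hq
  have he0 : ∀ a, coeffSum a = 0 → ‖Finsupp.linearCombination ℝ e a‖ = q a := fun a ha =>
    tendsto_nhds_unique (tendsto_of_coeffSum_eq_zero hA hF₁ hU hLU ha) (hq a)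
  have hes := fun κ hκ => hA.norm_comp_eq hF hF₁ hL (κ := κ) hκ
  -- models of `x - x₀` agree with `q` on vectors with vanishing coefficient sum
  have hf0 : ∀ (E' : Type w) [SeminormedAddCommGroup E'] [NormedSpace ℝ E'] (f : ℕ → E')
      (M : Set ℕ), M ⊆ L → M.Infinite → Approximates F M (fun s => x s - x₀) f →
      ∀ a, coeffSum a = 0 → ‖Finsupp.linearCombination ℝ f a‖ = q a := by
    intro E' _ _ f M hML hM hf a ha
    obtain ⟨V, hV, hMV⟩ := exists_ultrafilter_mem hM
    rw [← he0 a ha]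
    exact tendsto_nhds_unique (hf.tendsto_genericSeq (hF := hF) hF₁ hV hMV a)
      (tendsto_of_coeffSum_eq_zero hA hF₁ hV (mem_of_superset hMV hML) ha)
  by_cases hd : ∃ d > 0, ∀ a : ℕ →₀ ℝ, (∀ i, 0 ≤ a i) → d * coeffSum a ≤ q a
  · obtain ⟨d, hd0, hd⟩ := hd
    have hel1 : EquivSeq e l1Basis := equivSeq_l1Basis hes (c := d / 4) (by positivity)
      fun a n hn => norm_lower_bound hqe he0 hes hd hn
    refine .inl ⟨⟨hel1, ?_⟩, fun h => h.1.not_basic hel1.isSchauderBasic⟩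
    rintro E' _ _ f ⟨M, hML, hM, hf⟩
    have hfA : Approximates F M (fun s => x s - x₀) f := hf.2
    have hfs := fun κ hκ => hfA.norm_comp_eq hF hF₁ hM (κ := κ) hκ
    exact equivSeq_l1Basis hfs (c := d / 4) (by positivity)
      fun a n hn => norm_lower_bound hqe (hf0 E' f M hML hM hf.2) hfs hd hn
  · obtain ⟨b, hb0, hb, hbq⟩ := exists_convex_tendsto_zero hd
    obtain ⟨e₀, he₀⟩ := exists_tendsto_completion he0 hb hbq
    set e' : ℕ → UniformSpace.Completion E := fun n => (e n : UniformSpace.Completion E) - e₀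
      with he'
    have hΛ : ∀ a, Finsupp.linearCombination ℝ e' a =
        ((Finsupp.linearCombination ℝ e a : E) : UniformSpace.Completion E) -
          coeffSum a • e₀ := fun a => by
      rw [he', linearCombination_sub_const, linearCombination_coe]
    have hbe' : Tendsto (fun m => ‖Finsupp.linearCombination ℝ e' (b m)‖) atTop (𝓝 0) := by
      simp only [hΛ, hb, one_smul]
      exact tendsto_iff_norm_sub_tendsto_zero.1 he₀
    have he'q : ∀ a, ‖Finsupp.linearCombination ℝ e' a‖ = q a :=
      norm_eq_of_tendsto_zero (fun a ha => by
        rw [hΛ, ha, zero_smul, sub_zero, UniformSpace.Completion.norm_coe, he0 a ha]) hb hbq hbe'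
    obtain ⟨M, hML, hM, hMe'⟩ := exists_approximates (hF := hF) (e := e') hne hU hLU hCy
      (fun a => by rw [he'q]; exact hq a)
    have he's := fun κ hκ => hMe'.norm_comp_eq hF hF₁ hM (κ := κ) hκ
    have hqs : ∀ κ : ℕ → ℕ, StrictMono κ → ∀ a : ℕ →₀ ℝ, q (a.mapDomain κ) = q a :=
      fun κ hκ a => by
        rw [← he'q, ← he'q, Finsupp.linearCombination_mapDomain, he's κ hκ]
    -- The translation may depend on `m`, since it has to pass the support of `b m`.
    have hshift : ∀ n : ℕ → ℕ, Tendsto (fun m => q (subShift (n m) (b m))) atTop (𝓝 0) := fun n =>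
      squeeze_zero (fun _ => apply_nonneg _ _) (fun m => seminorm_subShift_le hqs (n m) (b m))
        (by simpa using hbq.const_mul 2)
    have hnorm : ‖e₀‖ = ‖x₀‖ := by
      have h1 := he₀.norm
      simp only [UniformSpace.Completion.norm_coe] at h1
      refine tendsto_nhds_unique h1 (tendsto_iff_dist_tendsto_zero.2 ?_)
      refine squeeze_zero (fun _ => dist_nonneg) (fun m => ?_) hbq
      have := hA.abs_norm_sub_le hF₁ hU hLU hq (b m)
      rwa [hb, one_smul] at this
    -- Basicness bounds `‖Λ e (b m)‖`, which tends to `‖x₀‖`, by a multiple of `q (subShift _ (b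
    -- m))`, which tends to `0`.
    have hnb : ¬ IsSchauderBasic e := fun h => by
      obtain ⟨K, hK⟩ := h.norm_le
      choose n hn using fun m => exists_support_subset_range (b m)
      have h1 := he₀.norm
      simp only [UniformSpace.Completion.norm_coe] at h1
      have h2 := le_of_tendsto_of_tendsto' h1 ((hshift fun m => n m + 1).const_mul K) fun m => by
        have := hK (b m) _ (hn m)
        rwa [he0 _ (coeffSum_subShift _ _)] at this
      rw [mul_zero, hnorm] at h2
      exact hx₀ (norm_le_zero_iff.1 h2)
    have he'0 : ∀ n, e' n ≠ 0 := fun n hn => hnt fun i j => by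
      have h0 : ∀ k, e' k = 0 := fun k => by
        rw [← norm_eq_zero, norm_eq_norm_zero he's, ← norm_eq_norm_zero he's n, hn, norm_zero]
      rw [← UniformSpace.Completion.norm_coe, UniformSpace.Completion.coe_sub,
        ← sub_sub_sub_cancel_right _ _ e₀]
      change ‖e' i - e' j‖ = 0
      rw [h0, h0, sub_zero, norm_zero]
    refine .inr ⟨⟨⟨isSpreading_of_norm_comp_eq hes, hnt, hnb⟩, e₀, ⟨?_, ?_⟩, hnorm,
      ⟨M, hML, hM, ?_, hMe'⟩, ?_⟩, fun h => hnb h.1.isSchauderBasic⟩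
    · rw [← norm_ne_zero_iff, hnorm]
      exact norm_ne_zero_iff.2 hx₀
    · refine tendsto_toWeakSpace_iff fun g => ?_
      have := (weak_limit_zero he's hb0 hb hbe' g).add_const (g e₀)
      simpa [he', map_sub] using this
    · exact linearIndependent_of_norm_erase_le (fun a i => by
        rw [he'q, he'q]; exact hqe a i) he'0
    · rintro E' _ _ f ⟨M', hML', hM', hf⟩ n a
      obtain ⟨V, hV, hMV⟩ := exists_ultrafilter_mem hM'
      have hf0' := hf0 E' f M' hML' hM' hf.2
      have hfe := (hψ V M' hV hML' hMV).norm_erase_le hψ0 hF hF₁ hV hMV hf.2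
      choose k hk using fun m => exists_support_subset_range (b m)
      -- A priori `f` agrees with `q` only on sum zero. Suppression for `f` bounds its norm at `b m`
      -- by that at the difference with a translate, where `q` is available.
      have hbf : Tendsto (fun m => ‖Finsupp.linearCombination ℝ f (b m)‖) atTop (𝓝 0) := by
        refine squeeze_zero (fun _ => norm_nonneg _) (fun m => ?_) (hshift fun m => k m + 1)
        rw [← hf0' _ (coeffSum_subShift _ _)]
        nth_rewrite 1 [← filter_subShift (hk m)]
        exact seminorm_filter_le (q := (normSeminorm ℝ E').comp (Finsupp.linearCombination ℝ f))
          hfe _ _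
      rw [← linearCombination_cut, ← linearCombination_cut, he'q,
        norm_eq_of_tendsto_zero hf0' hb hbq hbf]
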